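/- Let $G=(A\cup B,E)$ be a finite bipartite graph ($A$ men, $B$ women) in which every vertex has an adjacency list that is a linearly ordered list of ties (nonempty disjoint sets of neighbours; the vertex is indifferent within a tie and strictly prefers earlier ties). Write $y\succeq_x z$ if $x$ weakly prefers $y$ to $z$, and also if $z = M(x)$ and $x$ is unmatched in $M$. For a subgraph $H$ of $G$ (with the preferences of $G$), an edge $(x,y)\in H\setminus M$ blocks a matching $M\subseteq H$ if $y\succeq_x M(x)$ and $x\succeq_y M(y)$; $M$ is super-stable in $H$ if no edge of $H$ blocks it. $M$ dominates $N$ if every man who is matched in $N$ is matched in $M$ and weakly prefers his partner in $M$ to his partner in $N$. A member of a set of super-stable matchings is man-optimal in it if it dominates every member of the set. Fix an edge $(m,w)\in E$, and let $G'$ be the graph obtained from $G$ by removing $m$ and $w$ together with all their edges, then, for every $m'$ with $(m',w)\in E$ and $m'\succeq_w m$, all edges $(m',w')\in E$ with $w\succeq_{m'}w'$, and, for every $w'$ with $(m,w')\in E$ and $w'\succeq_m w$, all edges $(m',w')\in E$ with $m\succeq_{w'}m'$. Consider the following algorithm (Algorithm 1): compute $G'$; compute the man-optimal super-stable matching $M'$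 of $G'$ or find that $G'$ has no super-stable matching; if $M'$ exists and $M'\cup\{(m,w)\}$ is super-stable in $G$, return $M'\cup\{(m,w)\}$, otherwise report that no super-stable matching of $G$ contains $(m,w)$. **Theorem.** Algorithm 1 is correct: if it returns a matching, this is the man-optimal one among the super-stable matchings of $G$ that contain $(m,w)$, and if it reports failure, no super-stable matching of $G$ contains $(m,w)$. Moreover, its three phases (computing $G'$, computing $M'$, computing the answer) can be implemented on a unit-cost random access machine so that, on every input consisting of $G$, given by its adjacency lists, and an edge $(m,w)$ of $G$, the total running time is $O(|E|)$, with an absolute implied constant. -/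

import Mathlib

/-! ## Bipartite graphs with ordered adjacency lists of ties -/

/-- An instance with men `Fin p` and women `Fin q`.  The adjacency list of every vertex is a linearly
ordered list of ties, the best tie first; ties are nonempty and pairwise disjoint (the order in which
a tie lists its own members is immaterial).  A man lists a woman iff she lists him. -/
structure TieInstance (p q : ℕ) where
  menLists : Fin p → List (List (Fin q))
  womenLists : Fin q → List (List (Fin p))
  men_ties_nonempty : ∀ a, [] ∉ menLists a
  women_ties_nonempty : ∀ b, [] ∉ womenLists b
  men_nodup : ∀ a, (menLists a).flatten.Nodup
  women_nodup : ∀ b, (womenLists b).flatten.Nodup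
  mem_iff : ∀ a b, b ∈ (menLists a).flatten ↔ a ∈ (womenLists b).flatten

namespace TieInstance

variable {p q : ℕ} (I : TieInstance p q)

/-- The edge set `E` of the graph. -/
def edges : Finset (Fin p × Fin q) :=
  Finset.univ.filter fun e => e.2 ∈ (I.menLists e.1).flatten

/-- The position of the tie of `b` in the list of the man `a` (smaller is better). -/
def menRank (a : Fin p) (b : Fin q) : ℕ :=
  (I.menLists a).findIdx fun tie => decide (b ∈ tie)

/-- The position of the tie of `a` in the list of the woman `b` (smaller is better). -/
def womenRank (b : Fin q) (a : Fin p) : ℕ :=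
  (I.womenLists b).findIdx fun tie => decide (a ∈ tie)

/-- `I.manPrefers a b b'`: the man `a` weakly prefers `b` to `b'`. -/
def manPrefers (a : Fin p) (b b' : Fin q) : Prop := I.menRank a b ≤ I.menRank a b'

/-- `I.womanPrefers b a a'`: the woman `b` weakly prefers `a` to `a'`. -/
def womanPrefers (b : Fin q) (a a' : Fin p) : Prop := I.womenRank b a ≤ I.womenRank b a'

/-- `M` is a matching contained in the edge set `F`. -/
def IsMatching (F M : Finset (Fin p × Fin q)) : Prop :=
  M ⊆ F ∧ (∀ e ∈ M, ∀ f ∈ M, e.1 = f.1 → e = f) ∧ (∀ e ∈ M, ∀ f ∈ M, e.2 = f.2 → e = f)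

/-- The edge `e ∈ F \ M` blocks `M` in the graph with edge set `F`: each endpoint is unmatched in `M`
or weakly prefers the other endpoint to its partner in `M`. -/
def Blocks (F M : Finset (Fin p × Fin q)) (e : Fin p × Fin q) : Prop :=
  e ∈ F ∧ e ∉ M ∧ (∀ b, (e.1, b) ∈ M → I.manPrefers e.1 e.2 b) ∧
    (∀ a, (a, e.2) ∈ M → I.womanPrefers e.2 e.1 a)

/-- The super-stable matchings of the subgraph with edge set `F` (preferences as in `I`). -/
def superStable (F : Finset (Fin p × Fin q)) : Set (Finset (Fin p × Fin q)) :=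
  {M | IsMatching F M ∧ ∀ e, ¬ I.Blocks F M e}

/-- The super-stable matchings of the whole graph that contain the edge `(m, w)`. -/
def superStableWith (m : Fin p) (w : Fin q) : Set (Finset (Fin p × Fin q)) :=
  {M | M ∈ I.superStable I.edges ∧ (m, w) ∈ M}

/-- `M` dominates `N`: each man weakly prefers his partner in `M` to his partner in `N`
(being matched is better than being unmatched). -/
def Dominates (M N : Finset (Fin p × Fin q)) : Prop :=
  ∀ a b', (a, b') ∈ N → ∃ b, (a, b) ∈ M ∧ I.manPrefers a b b'

/-- The correct answers to "give the man-optimal member of `S`, or report that `S` is empty". -/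
def IsManOptimalAnswer (S : Set (Finset (Fin p × Fin q))) :
    Option (Finset (Fin p × Fin q)) → Prop
  | some M => M ∈ S ∧ ∀ N ∈ S, I.Dominates M N
  | none => S = ∅

open Classical in
/-- The edge set of the reduced graph: remove `m` and `w` with all their edges; for every edge
`(m', w)` such that `w` weakly prefers `m'` to `m`, remove all `(m', w')` such that `m'` weakly
prefers `w` to `w'`; and symmetrically for every edge `(m, w')`. -/
noncomputable def reducedEdges (m : Fin p) (w : Fin q) : Finset (Fin p × Fin q) :=
  I.edges.filter fun e => e.1 ≠ m ∧ e.2 ≠ w ∧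
    ¬ ((e.1, w) ∈ I.edges ∧ I.womanPrefers w e.1 m ∧ I.manPrefers e.1 w e.2) ∧
    ¬ ((m, e.2) ∈ I.edges ∧ I.manPrefers m e.2 w ∧ I.womanPrefers e.2 m e.1)

open Classical in
/-- The last step of the algorithm: given the man-optimal super-stable matching `M'` of the reduced
graph (if any), return `M' ∪ {(m, w)}` if it is super-stable in the whole graph, and report failure
in all other cases. -/
noncomputable def algResult (m : Fin p) (w : Fin q) :
    Option (Finset (Fin p × Fin q)) → Option (Finset (Fin p × Fin q))
  | some M' => if insert (m, w) M' ∈ I.superStable I.edges then some (insert (m, w) M') else none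
  | none => none

end TieInstance

/-! ## A random access machine with unit costs

Programs are finite, with finitely many registers and arrays of natural numbers.  Arithmetic is
restricted to `± 1`, so that after `t` steps all numbers are at most `t` plus the largest number in
the input and in the program: words of logarithmic size suffice. -/

namespace RAM

/-- A memory configuration: registers and arrays. -/
structure State where
  var : ℕ → ℕ
  arr : ℕ → ℕ → ℕ

/-- Expressions: constants, registers, array access, successor, (truncated) predecessor. -/
inductive Expr where
  | const (c : ℕ)
  | var (x : ℕ)
  | get (a : ℕ) (i : Expr)
  | succ (e : Expr)
  | pred (e : Expr)

def Expr.eval (s : State) : Expr → ℕ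
  | .const c => c
  | .var x => s.var x
  | .get a i => s.arr a (i.eval s)
  | .succ e => e.eval s + 1
  | .pred e => e.eval s - 1

/-- The number of elementary steps for evaluating an expression. -/
def Expr.cost : Expr → ℕ
  | .const _ => 1
  | .var _ => 1
  | .get _ i => i.cost + 1
  | .succ e => e.cost + 1
  | .pred e => e.cost + 1

/-- Tests. -/
inductive Test where
  | lt (e f : Expr)
  | eq (e f : Expr)
  | not (b : Test)
  | and (b c : Test)

def Test.Holds (s : State) : Test → Prop
  | .lt e f => e.eval s < f.eval s
  | .eq e f => e.eval s = f.eval s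
  | .not b => ¬ b.Holds s
  | .and b c => b.Holds s ∧ c.Holds s

/-- The number of elementary steps for evaluating a test. -/
def Test.cost : Test → ℕ
  | .lt e f => e.cost + f.cost + 1
  | .eq e f => e.cost + f.cost + 1
  | .not b => b.cost + 1
  | .and b c => b.cost + c.cost + 1

/-- Programs. -/
inductive Prog where
  | skip
  | assign (x : ℕ) (e : Expr)
  | put (a : ℕ) (i e : Expr)
  | seq (P Q : Prog)
  | ite (b : Test) (P Q : Prog)
  | while (b : Test) (P : Prog)

def State.setVar (s : State) (x v : ℕ) : State :=
  { s with var := Function.update s.var x v }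

def State.setArr (s : State) (a i v : ℕ) : State :=
  { s with arr := Function.update s.arr a (Function.update (s.arr a) i v) }

/-- `Exec P s t s'`: started in `s`, the program `P` halts in `s'` after exactly `t` steps. -/
inductive Exec : Prog → State → ℕ → State → Prop where
  | skip (s : State) : Exec .skip s 1 s
  | assign (x : ℕ) (e : Expr) (s : State) :
      Exec (.assign x e) s (e.cost + 1) (s.setVar x (e.eval s))
  | put (a : ℕ) (i e : Expr) (s : State) :
      Exec (.put a i e) s (i.cost + e.cost + 1) (s.setArr a (i.eval s) (e.eval s))
  | seq {P Q : Prog} {s s' s'' : State} {t t' : ℕ} (hP : Exec P s t s') (hQ : Exec Q s' t' s'') :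
      Exec (.seq P Q) s (t + t') s''
  | ite_true {b : Test} {P Q : Prog} {s s' : State} {t : ℕ} (hb : b.Holds s)
      (hP : Exec P s t s') : Exec (.ite b P Q) s (b.cost + 1 + t) s'
  | ite_false {b : Test} {P Q : Prog} {s s' : State} {t : ℕ} (hb : ¬ b.Holds s)
      (hQ : Exec Q s t s') : Exec (.ite b P Q) s (b.cost + 1 + t) s'
  | while_true {b : Test} {P : Prog} {s s' s'' : State} {t t' : ℕ} (hb : b.Holds s)
      (hP : Exec P s t s') (hW : Exec (.while b P) s' t' s'') :
      Exec (.while b P) s (b.cost + 1 + t + t') s''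
  | while_false {b : Test} {P : Prog} {s : State} (hb : ¬ b.Holds s) :
      Exec (.while b P) s (b.cost + 1) s

end RAM

/-! ## Input and output conventions -/

namespace TieInstance

/-- Concatenation of the adjacency lists `L v`, `v ∈ vs`.  The entry for the neighbour `u` in the
`i`-th tie of `v` is `(v, u, i)`. -/
def entries {α β : Type} (vs : List α) (L : α → List (List β)) : List (α × β × ℕ) :=
  vs.flatMap fun v => (L v).zipIdx.flatMap fun tie => tie.1.map fun u => (v, u, tie.2)

variable {p q : ℕ} (I : TieInstance p q)

/-- The concatenated adjacency lists of the men. -/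
def menEntries : List (Fin p × Fin q × ℕ) := entries (List.finRange p) I.menLists

/-- The concatenated adjacency lists of the women. -/
def womenEntries : List (Fin q × Fin p × ℕ) := entries (List.finRange q) I.womenLists

/-- The initial memory: registers `0, …, 4` hold `|E|`, `m`, `w`, the number of men and the number of
women; arrays `0, 1, 2` hold the adjacency lists of the men, arrays `3, 4, 5` those of the women (the
three components of the entries in three arrays); everything else is `0`. -/
def inputState (m : Fin p) (w : Fin q) : RAM.State where
  var := fun x => match x with
    | 0 => I.edges.card
    | 1 => m
    | 2 => w
    | 3 => p
    | 4 => q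
    | _ => 0
  arr := fun a k => match a with
    | 0 => (I.menEntries.map fun r => (r.1 : ℕ)).getD k 0
    | 1 => (I.menEntries.map fun r => (r.2.1 : ℕ)).getD k 0
    | 2 => (I.menEntries.map fun r => r.2.2).getD k 0
    | 3 => (I.womenEntries.map fun r => (r.1 : ℕ)).getD k 0
    | 4 => (I.womenEntries.map fun r => (r.2.1 : ℕ)).getD k 0
    | 5 => (I.womenEntries.map fun r => r.2.2).getD k 0
    | _ => 0

open Classical in
/-- Array `c` of `s` marks which entries of the men's adjacency lists are edges in `F`. -/
def HoldsEdgeSet (s : RAM.State) (c : ℕ) (F : Finset (Fin p × Fin q)) : Prop :=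
  ∀ (k : ℕ) (h : k < I.menEntries.length),
    s.arr c k = if ((I.menEntries[k]).1, (I.menEntries[k]).2.1) ∈ F then 1 else 0

/-- The memory `s` reports a matching or its absence: register `0` holds `1` if there is a matching
`M`, and then array `c` holds at `a` the number `b + 1` if `(a, b) ∈ M` and `0` if the man `a` is
unmatched in `M`; register `0` holds `0` if there is none. -/
def Reports (s : RAM.State) (c : ℕ) : Option (Finset (Fin p × Fin q)) → Prop
  | some M => s.var 0 = 1 ∧ ∀ a : Fin p,
      (∃ b : Fin q, (a, b) ∈ M ∧ s.arr c a = b + 1) ∨ ((∀ b : Fin q, (a, b) ∉ M) ∧ s.arr c a = 0)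
  | none => s.var 0 = 0

end TieInstance

/-! Reduction. If a super-stable matching `N` contains `(m, w)`, a deleted edge in `N` would make
some edge at `w` or at `m` block `N`. So `N` without `(m, w)` lives in the reduced graph and is
super-stable there (`erase_mem_superStable`). Conversely, let such an `N` exist and let `M'` be
man-optimal in the reduced graph. Then `M'` dominates the rest of `N`, so it matches all the men
matched there, and by counting all the women as well (`exists_man_of_dominates`). Vertices other
than `m`, `w` left single by `M'` are therefore single in `N`, and an edge blocking `M'` with `(m,
w)` added would lead to one blocking `N` (`insert_mem_superStable`). Hence a failed final test
proves that no `N` exists.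

Man-optimal matching. Men propose down their lists; a woman rejects every proposal for which she has
another one at least as good, so several best proposals reject each other. The set `T` of proposals
stays `Sound` throughout and is `Closed` at the end. For any super-stable `M`, every man of `M` then
has a live proposal and every woman with a proposal is matched in `M`. Comparing cardinalities
forces the live proposals to be a matching that serves every woman with a proposal
(`of_superStable_nonempty`). If they have this form, they are super-stable and dominate everything
(`live_mem_superStable`, `dominates_live`); so the existence of a super-stable matching is decided
by inspecting them.

Time. Loops are never nested, and `Runs n` charges each program a constant times `n`, where `n`
exceeds the number of passes of each loop. Counting loops make `|E|` passes; the two others are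
bounded by potentials of size at most `2 * |E|` and `3 * |E|`. Vertices are reached only through
edges and the unused memory is zero, so isolated vertices cost nothing. -/

namespace TieInstance

section Combinatorics

variable {p q : ℕ} (I : TieInstance p q)

/-! ## Super-stable matchings: counting and reduction -/

theorem IsMatching.card_image_fst {F M : Finset (Fin p × Fin q)} (h : IsMatching F M) :
    (M.image Prod.fst).card = M.card :=
  Finset.card_image_of_injOn fun e he f hf hef => h.2.1 e he f hf hef

theorem IsMatching.card_image_snd {F M : Finset (Fin p × Fin q)} (h : IsMatching F M) :
    (M.image Prod.snd).card = M.card :=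
  Finset.card_image_of_injOn fun e he f hf hef => h.2.2 e he f hf hef

variable {I}

/-- If `a` weakly prefers `b` to his partner (if any) in a super-stable matching not containing
`(a, b)`, then `b` has a partner whom she strictly prefers to `a`. -/
theorem exists_partner_of_superStable {F M : Finset (Fin p × Fin q)} (hM : M ∈ I.superStable F)
    {a : Fin p} {b : Fin q} (hF : (a, b) ∈ F) (hab : (a, b) ∉ M)
    (h : ∀ b', (a, b') ∈ M → I.manPrefers a b b') :
    ∃ a', (a', b) ∈ M ∧ ¬ I.womanPrefers b a a' := by
  by_contra hcon
  push Not at hcon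
  exact hM.2 (a, b) ⟨hF, hab, h, hcon⟩

/-- All women matched in a super-stable matching are matched in every one that dominates it. -/
theorem exists_man_of_dominates {F M N : Finset (Fin p × Fin q)} (hM : M ∈ I.superStable F)
    (hN : N ∈ I.superStable F) (hd : I.Dominates M N) {a : Fin p} {b : Fin q} (hb : (a, b) ∈ N) :
    ∃ a', (a', b) ∈ M := by
  have h1 : N.image Prod.fst ⊆ M.image Prod.fst := by
    intro x hx
    obtain ⟨⟨x, y⟩, he, rfl⟩ := Finset.mem_image.1 hx
    obtain ⟨b, hb, -⟩ := hd x y he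
    exact Finset.mem_image.2 ⟨_, hb, rfl⟩
  -- If `(x, y)` is in `M` but not in `N`, then `x` weakly prefers `y` to his partner in `N`; as
  -- `(x, y)` does not block `N`, the woman `y` is matched in `N`. So `M` matches no new woman, and
  -- having at least as many edges as `N` it matches exactly the same ones.
  have h2 : M.image Prod.snd ⊆ N.image Prod.snd := by
    intro y hy
    obtain ⟨⟨x, y⟩, he, rfl⟩ := Finset.mem_image.1 hy
    by_cases hxy : (x, y) ∈ N
    · exact Finset.mem_image.2 ⟨_, hxy, rfl⟩
    obtain ⟨a', ha', -⟩ := exists_partner_of_superStable hN (hM.1.1 he) hxy fun b' hb' => by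
      obtain ⟨c, hc, hcp⟩ := hd x b' hb'
      obtain rfl : c = y := congrArg Prod.snd (hM.1.2.1 _ hc _ he rfl)
      exact hcp
    exact Finset.mem_image.2 ⟨_, ha', rfl⟩
  have h3 : M.image Prod.snd = N.image Prod.snd := by
    apply Finset.eq_of_subset_of_card_le h2
    rw [hM.1.card_image_snd, hN.1.card_image_snd, ← hM.1.card_image_fst, ← hN.1.card_image_fst]
    exact Finset.card_le_card h1
  have h4 : b ∈ M.image Prod.snd := h3 ▸ Finset.mem_image.2 ⟨_, hb, rfl⟩
  obtain ⟨⟨x, y⟩, he, rfl⟩ := Finset.mem_image.1 h4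
  exact ⟨x, he⟩

variable {m : Fin p} {w : Fin q}

theorem mem_reducedEdges {e : Fin p × Fin q} : e ∈ I.reducedEdges m w ↔
    e ∈ I.edges ∧ e.1 ≠ m ∧ e.2 ≠ w ∧
    ¬ ((e.1, w) ∈ I.edges ∧ I.womanPrefers w e.1 m ∧ I.manPrefers e.1 w e.2) ∧
    ¬ ((m, e.2) ∈ I.edges ∧ I.manPrefers m e.2 w ∧ I.womanPrefers e.2 m e.1) := by
  simp only [reducedEdges, Finset.mem_filter]

theorem reducedEdges_subset : I.reducedEdges m w ⊆ I.edges := fun _ h =>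
  (mem_reducedEdges.1 h).1

/-- An edge `(a, b)` of `N` deleted by the first rule would make `(a, w)` block `N`, and one deleted
by the second would make `(m, b)` block it. Surviving edges avoid `m` and `w`, so their endpoints
have the same partners before and after the erasure, and no new blocking edge appears. -/
theorem erase_mem_superStable {N : Finset (Fin p × Fin q)} (hN : N ∈ I.superStableWith m w) :
    N.erase (m, w) ∈ I.superStable (I.reducedEdges m w) := by
  obtain ⟨⟨⟨hNE, hN1, hN2⟩, hNb⟩, hmw⟩ := hN
  have hm : ∀ e ∈ N.erase (m, w), e.1 ≠ m := fun e he h =>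
    (Finset.mem_erase.1 he).1 (hN1 e (Finset.mem_of_mem_erase he) _ hmw h)
  have hw : ∀ e ∈ N.erase (m, w), e.2 ≠ w := fun e he h =>
    (Finset.mem_erase.1 he).1 (hN2 e (Finset.mem_of_mem_erase he) _ hmw h)
  refine ⟨⟨?_, fun e he f hf => hN1 e (Finset.mem_of_mem_erase he) f (Finset.mem_of_mem_erase hf),
    fun e he f hf => hN2 e (Finset.mem_of_mem_erase he) f (Finset.mem_of_mem_erase hf)⟩, ?_⟩
  · rintro ⟨a, b⟩ he
    have heN := Finset.mem_of_mem_erase he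
    refine mem_reducedEdges.2 ⟨hNE heN, hm _ he, hw _ he, ?_, ?_⟩
    · rintro ⟨h1, h2, h3⟩
      refine hNb (a, w) ⟨h1, fun h => hw _ he ?_, fun b' hb' => ?_, fun a' ha' => ?_⟩
      · exact congrArg Prod.snd (hN1 _ heN _ h rfl)
      · obtain rfl : b' = b := congrArg Prod.snd (hN1 _ hb' _ heN rfl)
        exact h3
      · obtain rfl : a' = m := congrArg Prod.fst (hN2 _ ha' _ hmw rfl)
        exact h2
    · rintro ⟨h1, h2, h3⟩
      refine hNb (m, b) ⟨h1, fun h => hm _ he ?_, fun b' hb' => ?_, fun a' ha' => ?_⟩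
      · exact congrArg Prod.fst (hN2 _ heN _ h rfl)
      · obtain rfl : b' = w := congrArg Prod.snd (hN1 _ hb' _ hmw rfl)
        exact h2
      · obtain rfl : a' = a := congrArg Prod.fst (hN2 _ ha' _ heN rfl)
        exact h3
  · rintro ⟨a, b⟩ ⟨h1, h2, h3, h4⟩
    obtain ⟨hE, ham, hbw, -, -⟩ := mem_reducedEdges.1 h1
    have hne : ∀ e : Fin p × Fin q, e.1 = a ∨ e.2 = b → e ≠ (m, w) := by
      rintro e (h | h) rfl
      exacts [ham h.symm, hbw h.symm]
    exact hNb (a, b) ⟨hE, fun h => h2 (Finset.mem_erase.2 ⟨hne _ (.inl rfl), h⟩),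
      fun b' hb' => h3 b' (Finset.mem_erase.2 ⟨hne _ (.inl rfl), hb'⟩),
      fun a' ha' => h4 a' (Finset.mem_erase.2 ⟨hne _ (.inr rfl), ha'⟩)⟩

theorem insert_isMatching {M' : Finset (Fin p × Fin q)} (hmw : (m, w) ∈ I.edges)
    (hM' : IsMatching (I.reducedEdges m w) M') : IsMatching I.edges (insert (m, w) M') := by
  have hm : ∀ e ∈ M', e.1 ≠ m := fun e he => (mem_reducedEdges.1 (hM'.1 he)).2.1
  have hw : ∀ e ∈ M', e.2 ≠ w := fun e he => (mem_reducedEdges.1 (hM'.1 he)).2.2.1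
  refine ⟨Finset.insert_subset hmw (hM'.1.trans reducedEdges_subset), ?_, ?_⟩
  · intro e he f hf hef
    rcases Finset.mem_insert.1 he with rfl | he <;> rcases Finset.mem_insert.1 hf with rfl | hf
    exacts [rfl, absurd hef.symm (hm f hf), absurd hef (hm e he), hM'.2.1 e he f hf hef]
  · intro e he f hf hef
    rcases Finset.mem_insert.1 he with rfl | he <;> rcases Finset.mem_insert.1 hf with rfl | hf
    exacts [rfl, absurd hef.symm (hw f hf), absurd hef (hw e he), hM'.2.2 e he f hf hef]

/-- The matching `N` serves only as a witness: vertices left single by `M'` are single in `N`, and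
super-stability of `N` then excludes that they threaten `m` or `w`. -/
theorem insert_mem_superStable {M' N : Finset (Fin p × Fin q)} (hmw : (m, w) ∈ I.edges)
    (hM' : M' ∈ I.superStable (I.reducedEdges m w))
    (hd : ∀ N ∈ I.superStable (I.reducedEdges m w), I.Dominates M' N)
    (hN : N ∈ I.superStableWith m w) : insert (m, w) M' ∈ I.superStable I.edges := by
  refine ⟨insert_isMatching hmw hM'.1, ?_⟩
  have hN' := erase_mem_superStable hN
  obtain ⟨⟨⟨hNE, hN1, hN2⟩, hNb⟩, hmwN⟩ := hN
  have hdN := hd _ hN'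
  -- a vertex other than `m`, `w` that is unmatched in `M'` is unmatched in `N`
  have man_un : ∀ a, a ≠ m → (∀ b, (a, b) ∉ M') → ∀ b, (a, b) ∉ N := by
    intro a ha h b hb
    obtain ⟨c, hc, -⟩ := hdN a b (Finset.mem_erase.2 ⟨fun h => ha (congrArg Prod.fst h), hb⟩)
    exact h c hc
  have woman_un : ∀ b, b ≠ w → (∀ a, (a, b) ∉ M') → ∀ a, (a, b) ∉ N := by
    intro b hbw h a ha
    obtain ⟨c, hc⟩ := exists_man_of_dominates hM' hN' hdN
      (Finset.mem_erase.2 ⟨fun h => hbw (congrArg Prod.snd h), ha⟩)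
    exact h c hc
  -- Partners of `a` that are not strictly better than `w` were deleted. So if the claim fails, `a`
  -- is single in `M'`, hence in `N`, and `(a, w)` blocks `N`.
  have man_case : ∀ a, a ≠ m → (a, w) ∈ I.edges → I.womanPrefers w a m →
      ∃ b, (a, b) ∈ M' ∧ ¬ I.manPrefers a w b := by
    intro a ha hE hp
    by_contra hcon
    push Not at hcon
    have hun : ∀ b, (a, b) ∉ M' := fun b hb =>
      (mem_reducedEdges.1 (hM'.1.1 hb)).2.2.2.1 ⟨hE, hp, hcon b hb⟩
    refine hNb (a, w) ⟨hE, man_un a ha hun w, fun b hb => absurd hb (man_un a ha hun b),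
      fun a' ha' => ?_⟩
    obtain rfl : a' = m := congrArg Prod.fst (hN2 _ ha' _ hmwN rfl)
    exact hp
  have woman_case : ∀ b, b ≠ w → (m, b) ∈ I.edges → I.manPrefers m b w →
      ∃ a, (a, b) ∈ M' ∧ ¬ I.womanPrefers b m a := by
    intro b hb hE hp
    by_contra hcon
    push Not at hcon
    have hun : ∀ a, (a, b) ∉ M' := fun a ha =>
      (mem_reducedEdges.1 (hM'.1.1 ha)).2.2.2.2 ⟨hE, hp, hcon a ha⟩
    refine hNb (m, b) ⟨hE, woman_un b hb hun m, fun b' hb' => ?_,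
      fun a ha => absurd ha (woman_un b hb hun a)⟩
    obtain rfl : b' = w := congrArg Prod.snd (hN1 _ hb' _ hmwN rfl)
    exact hp
  rintro ⟨x, y⟩ ⟨hE, hnot, hx, hy⟩
  by_cases hxm : x = m
  · subst hxm
    have hyw : y ≠ w := fun h => hnot (h ▸ Finset.mem_insert_self _ _)
    obtain ⟨a, ha, hna⟩ := woman_case y hyw hE (hx w (Finset.mem_insert_self _ _))
    exact hna (hy a (Finset.mem_insert_of_mem ha))
  by_cases hyw : y = w
  · subst hyw
    obtain ⟨b, hb, hnb⟩ := man_case x hxm hE (hy m (Finset.mem_insert_self _ _))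
    exact hnb (hx b (Finset.mem_insert_of_mem hb))
  -- An edge deleted by the first rule cannot block: `x` has a partner strictly better than `w`, who
  -- is weakly better than `y`. The second rule is symmetric, and all remaining edges belong to the
  -- reduced graph.
  by_cases h1 : (x, w) ∈ I.edges ∧ I.womanPrefers w x m ∧ I.manPrefers x w y
  · obtain ⟨b, hb, hnb⟩ := man_case x hxm h1.1 h1.2.1
    exact hnb (h1.2.2.trans (hx b (Finset.mem_insert_of_mem hb)))
  by_cases h2 : (m, y) ∈ I.edges ∧ I.manPrefers m y w ∧ I.womanPrefers y m x
  · obtain ⟨a, ha, hna⟩ := woman_case y hyw h2.1 h2.2.1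
    exact hna (h2.2.2.trans (hy a (Finset.mem_insert_of_mem ha)))
  exact hM'.2 (x, y) ⟨mem_reducedEdges.2 ⟨hE, hxm, hyw, h1, h2⟩,
    fun h => hnot (Finset.mem_insert_of_mem h), fun b hb => hx b (Finset.mem_insert_of_mem hb),
    fun a ha => hy a (Finset.mem_insert_of_mem ha)⟩

/-- Correctness of the algorithm. -/
theorem algResult_isManOptimalAnswer (hmw : (m, w) ∈ I.edges)
    (M' : Option (Finset (Fin p × Fin q)))
    (h : I.IsManOptimalAnswer (I.superStable (I.reducedEdges m w)) M') :
    I.IsManOptimalAnswer (I.superStableWith m w) (I.algResult m w M') := by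
  cases M' with
  | none =>
    refine Set.eq_empty_of_forall_notMem fun N hN => ?_
    have := erase_mem_superStable hN
    rw [show I.superStable (I.reducedEdges m w) = ∅ from h] at this
    exact this
  | some M' =>
    obtain ⟨hM', hd⟩ := h
    simp only [algResult]
    split_ifs with hs
    · refine ⟨⟨hs, Finset.mem_insert_self _ _⟩, fun N hN a b' hb' => ?_⟩
      by_cases ham : a = m
      · subst ham
        obtain rfl : b' = w := congrArg Prod.snd (hN.1.1.2.1 _ hb' _ hN.2 rfl)
        exact ⟨b', Finset.mem_insert_self _ _, le_rfl⟩
      · obtain ⟨b, hb, hp⟩ := hd _ (erase_mem_superStable hN) a b'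
          (Finset.mem_erase.2 ⟨fun h => ham (congrArg Prod.fst h), hb'⟩)
        exact ⟨b, Finset.mem_insert_of_mem hb, hp⟩
    · exact Set.eq_empty_of_forall_notMem fun N hN => hs (insert_mem_superStable hmw hM' hd hN)

/-! ## Proposals -/

variable (I)

/-- The edge `e` is rejected because of the set `T` of proposals: its woman has another proposal
which she weakly prefers. -/
def Rejected (T : Finset (Fin p × Fin q)) (e : Fin p × Fin q) : Prop :=
  ∃ a, (a, e.2) ∈ T ∧ a ≠ e.1 ∧ I.womanPrefers e.2 a e.1

open Classical in
/-- The proposals in `T` that are not rejected because of `T`. -/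
noncomputable def live (T : Finset (Fin p × Fin q)) : Finset (Fin p × Fin q) :=
  T.filter fun e => ¬ I.Rejected T e

/-- `T` is sound for `F`: no man does strictly better in a super-stable matching than in any of
his proposals. -/
def Sound (F T : Finset (Fin p × Fin q)) : Prop :=
  T ⊆ F ∧ ∀ a b, (a, b) ∈ T → ∀ M ∈ I.superStable F, ∀ b', (a, b') ∈ M → I.manPrefers a b b'

/-- `T` contains every edge whose man has been rejected by all women he strictly prefers. -/
def Closed (F T : Finset (Fin p × Fin q)) : Prop :=
  ∀ a b, (a, b) ∈ F →
    (∀ b', (a, b') ∈ F → ¬ I.manPrefers a b b' → I.Rejected T (a, b')) → (a, b) ∈ T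

variable {I} {F T M : Finset (Fin p × Fin q)}

theorem mem_live {e : Fin p × Fin q} : e ∈ I.live T ↔ e ∈ T ∧ ¬ I.Rejected T e := by
  simp only [live, Finset.mem_filter]

theorem live_subset : I.live T ⊆ T := fun _ h => (mem_live.1 h).1

/-- Ranks are totally ordered and equality already rejects, so of two proposals to one woman at
least one is rejected because of the other. -/
theorem eq_of_mem_live {a a' : Fin p} {b : Fin q} (h : (a, b) ∈ I.live T)
    (h' : (a', b) ∈ I.live T) : a = a' := by
  by_contra hne
  rw [mem_live] at h h'
  rcases le_total (I.womenRank b a) (I.womenRank b a') with hle | hle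
  · exact h'.2 ⟨a, h.1, hne, hle⟩
  · exact h.2 ⟨a', h'.1, Ne.symm hne, hle⟩

/-- The rejecting proposer weakly prefers this woman to whatever `M` gives him, by soundness, and
she weakly prefers him to her partner in `M`; so his proposal would block `M`. -/
theorem Sound.not_rejected (hT : I.Sound F T) (hM : M ∈ I.superStable F) {e : Fin p × Fin q}
    (he : e ∈ M) : ¬ I.Rejected T e := by
  rintro ⟨a, ha, hne, hp⟩
  have hab : (a, e.2) ∉ M := fun h => hne (congrArg Prod.fst (hM.1.2.2 _ h _ he rfl))
  obtain ⟨a', ha', hp'⟩ := exists_partner_of_superStable hM (hT.1 ha) hab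
    (hT.2 _ _ ha M hM)
  obtain rfl : a' = e.1 := congrArg Prod.fst (hM.1.2.2 _ ha' _ he rfl)
  exact hp' hp

theorem Sound.insert_of_rejected (hT : I.Sound F T) {a : Fin p} {b : Fin q} (hF : (a, b) ∈ F)
    (h : ∀ b', (a, b') ∈ F → ¬ I.manPrefers a b b' → I.Rejected T (a, b')) :
    I.Sound F (insert (a, b) T) := by
  refine ⟨Finset.insert_subset hF hT.1, fun x y hxy M hM y' hy' => ?_⟩
  rcases Finset.mem_insert.1 hxy with hxy | hxy
  · obtain ⟨rfl, rfl⟩ := Prod.mk.inj hxy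
    by_contra hcon
    exact hT.not_rejected hM hy' (h y' (hM.1.1 hy') hcon)
  · exact hT.2 x y hxy M hM y' hy'

theorem Sound.insert_of_tie (hT : I.Sound F T) {a : Fin p} {b b₀ : Fin q} (hF : (a, b) ∈ F)
    (h₀ : (a, b₀) ∈ T) (h : I.menRank a b₀ = I.menRank a b) : I.Sound F (insert (a, b) T) := by
  refine ⟨Finset.insert_subset hF hT.1, fun x y hxy M hM y' hy' => ?_⟩
  rcases Finset.mem_insert.1 hxy with hxy | hxy
  · obtain ⟨rfl, rfl⟩ := Prod.mk.inj hxy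
    exact h.symm.le.trans (hT.2 x b₀ h₀ M hM y' hy')
  · exact hT.2 x y hxy M hM y' hy'

/-- Take an edge of `a` of best rank among those not rejected. Everything strictly better is
rejected, so closedness puts it into `T`. -/
theorem Closed.exists_live (hC : I.Closed F T) {a : Fin p} {b : Fin q} (hF : (a, b) ∈ F)
    (hR : ¬ I.Rejected T (a, b)) : ∃ b', (a, b') ∈ I.live T ∧ I.manPrefers a b' b := by
  classical
  obtain ⟨c, hc, hmin⟩ := Finset.exists_min_image
    (Finset.univ.filter fun b' => (a, b') ∈ F ∧ ¬ I.Rejected T (a, b')) (I.menRank a)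
    ⟨b, by simp [hF, hR]⟩
  simp only [Finset.mem_filter, Finset.mem_univ, true_and] at hc hmin
  refine ⟨c, mem_live.2 ⟨hC a c hc.1 fun b' hb' hp => ?_, hc.2⟩, hmin b ⟨hF, hR⟩⟩
  by_contra hcon
  exact hp (hmin b' ⟨hb', hcon⟩)

theorem dominates_live (hT : I.Sound F T) (hC : I.Closed F T) (hM : M ∈ I.superStable F) :
    I.Dominates (I.live T) M := fun _ _ hb' =>
  hC.exists_live (hM.1.1 hb') (hT.not_rejected hM hb')

/-- The live proposals form a super-stable matching if no man has two of them and every woman with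
a proposal has one of them. -/
theorem live_mem_superStable (hT : I.Sound F T) (hC : I.Closed F T)
    (h1 : ∀ a b b', (a, b) ∈ I.live T → (a, b') ∈ I.live T → b = b')
    (h2 : ∀ a b, (a, b) ∈ T → ∃ a', (a', b) ∈ I.live T) : I.live T ∈ I.superStable F := by
  refine ⟨⟨live_subset.trans hT.1, ?_, ?_⟩, ?_⟩
  · rintro ⟨a, b⟩ he ⟨a', b'⟩ hf rfl
    exact congrArg (Prod.mk a) (h1 a b b' he hf)
  · rintro ⟨a, b⟩ he ⟨a', b'⟩ hf rfl
    exact congrArg (·, b) (eq_of_mem_live he hf)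
  · rintro ⟨a, b⟩ ⟨hF, hn, ha, hb⟩
    -- If some strictly better `b'` had not rejected `a`, he would hold a live proposal strictly
    -- better than `b`, so the edge would not block. Once `(a, b)` is a proposal, it rejects the
    -- live proposal that `b` has, a contradiction.
    have habT : (a, b) ∈ T := hC a b hF fun b' hb' hp => by
      by_contra hcon
      obtain ⟨c, hc, hcp⟩ := hC.exists_live hb' hcon
      exact hp ((ha c hc).trans hcp)
    obtain ⟨a', ha'⟩ := h2 a b habT
    exact (mem_live.1 ha').2 ⟨a, habT, fun h => hn (h ▸ ha'), hb a' ha'⟩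

/-- The men of `M` are among the men of the live proposals, and the women of the live proposals are
among those of `T`, which are among those of `M`. Live proposals have distinct women, so the
resulting chain of cardinalities begins and ends with the size of `M`, and every inequality in it is
an equality. -/
theorem of_superStable_nonempty (hT : I.Sound F T) (hC : I.Closed F T)
    (hM : M ∈ I.superStable F) :
    (∀ a b b', (a, b) ∈ I.live T → (a, b') ∈ I.live T → b = b') ∧
      ∀ a b, (a, b) ∈ T → ∃ a', (a', b) ∈ I.live T := by
  have c1 : M.image Prod.fst ⊆ (I.live T).image Prod.fst := by
    intro x hx
    obtain ⟨⟨x, y⟩, he, rfl⟩ := Finset.mem_image.1 hx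
    obtain ⟨b, hb, -⟩ := dominates_live hT hC hM x y he
    exact Finset.mem_image.2 ⟨_, hb, rfl⟩
  have c2 : (I.live T).image Prod.snd ⊆ T.image Prod.snd := Finset.image_subset_image live_subset
  have c3 : T.image Prod.snd ⊆ M.image Prod.snd := by
    intro y hy
    obtain ⟨⟨x, y⟩, he, rfl⟩ := Finset.mem_image.1 hy
    by_cases hxy : (x, y) ∈ M
    · exact Finset.mem_image.2 ⟨_, hxy, rfl⟩
    obtain ⟨a', ha', -⟩ := exists_partner_of_superStable hM (hT.1 he) hxy (hT.2 _ _ he M hM)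
    exact Finset.mem_image.2 ⟨_, ha', rfl⟩
  have c4 : ((I.live T).image Prod.snd).card = (I.live T).card := by
    refine Finset.card_image_of_injOn ?_
    rintro ⟨a, b⟩ he ⟨a', b'⟩ hf (rfl : b = b')
    exact congrArg (·, b) (eq_of_mem_live he hf)
  have l1 := Finset.card_le_card c1
  have l2 := Finset.card_le_card c2
  have l3 := Finset.card_le_card c3
  have l4 : ((I.live T).image Prod.fst).card ≤ (I.live T).card := Finset.card_image_le
  rw [hM.1.card_image_fst] at l1
  rw [hM.1.card_image_snd] at l3
  constructor
  · intro a b b' h h'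
    have hinj := Finset.card_image_iff.1 (show ((I.live T).image Prod.fst).card = _ by omega)
    exact congrArg Prod.snd (hinj h h' rfl)
  · intro a b h
    have heq := Finset.eq_of_subset_of_card_le c2 (by omega)
    have hb : b ∈ (I.live T).image Prod.snd := heq ▸ Finset.mem_image.2 ⟨_, h, rfl⟩
    obtain ⟨⟨x, y⟩, he, rfl⟩ := Finset.mem_image.1 hb
    exact ⟨x, he⟩

end Combinatorics

end TieInstance

namespace RAM

/-! ## Verification of programs whose loops have loop-free bodies -/

theorem State.setVar_var (s : State) (x v y : ℕ) :
    (s.setVar x v).var y = if y = x then v else s.var y := by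
  simp [State.setVar, Function.update_apply]

@[simp] theorem State.setVar_self (s : State) (x v : ℕ) : (s.setVar x v).var x = v := by
  simp [State.setVar_var]

@[simp] theorem State.setVar_ne (s : State) {x y : ℕ} (v : ℕ) (h : y ≠ x) :
    (s.setVar x v).var y = s.var y := by
  simp [State.setVar_var, h]

@[simp] theorem State.setVar_arr (s : State) (x v : ℕ) : (s.setVar x v).arr = s.arr := rfl

@[simp] theorem State.setArr_var (s : State) (a i v : ℕ) : (s.setArr a i v).var = s.var := rfl

theorem State.setArr_arr (s : State) (a i v b j : ℕ) :
    (s.setArr a i v).arr b j = if b = a ∧ j = i then v else s.arr b j := by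
  by_cases h : b = a
  · subst h
    simp [State.setArr, Function.update_apply]
  · simp [State.setArr, h]

@[simp] theorem State.setArr_self (s : State) (a i v j : ℕ) :
    (s.setArr a i v).arr a j = if j = i then v else s.arr a j := by
  simp [State.setArr_arr]

@[simp] theorem State.setArr_ne (s : State) {a b : ℕ} (i v j : ℕ) (h : b ≠ a) :
    (s.setArr a i v).arr b j = s.arr b j := by
  simp [State.setArr_arr, h]

theorem State.setArr_arr_self (s : State) (a i v : ℕ) :
    (s.setArr a i v).arr a = Function.update (s.arr a) i v :=
  Function.update_self _ _ _

theorem State.setArr_arr_ne (s : State) {a b : ℕ} (i v : ℕ) (h : b ≠ a) :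
    (s.setArr a i v).arr b = s.arr b :=
  Function.update_of_ne h _ _

namespace Prog

/-- The program has no loops. -/
def loopFree : Prog → Bool
  | .skip => true
  | .assign _ _ => true
  | .put _ _ _ => true
  | .seq P Q => P.loopFree && Q.loopFree
  | .ite _ P Q => P.loopFree && Q.loopFree
  | .while _ _ => false

/-- An upper bound for the number of steps in which every loop body is executed once. -/
def bound : Prog → ℕ
  | .skip => 1
  | .assign _ e => e.cost + 1
  | .put _ i e => i.cost + e.cost + 1
  | .seq P Q => P.bound + Q.bound
  | .ite b P Q => b.cost + 1 + P.bound + Q.bound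
  | .while b P => b.cost + 1 + P.bound

/-- The registers to which the program assigns. -/
def vars : Prog → List ℕ
  | .skip => []
  | .assign x _ => [x]
  | .put _ _ _ => []
  | .seq P Q => P.vars ++ Q.vars
  | .ite _ P Q => P.vars ++ Q.vars
  | .while _ P => P.vars

/-- The arrays to which the program writes. -/
def arrs : Prog → List ℕ
  | .skip => []
  | .assign _ _ => []
  | .put a _ _ => [a]
  | .seq P Q => P.arrs ++ Q.arrs
  | .ite _ P Q => P.arrs ++ Q.arrs
  | .while _ P => P.arrs

open Classical in
/-- The effect of a loop-free program. -/
noncomputable def run : Prog → State → State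
  | .skip, s => s
  | .assign x e, s => s.setVar x (e.eval s)
  | .put a i e, s => s.setArr a (i.eval s) (e.eval s)
  | .seq P Q, s => Q.run (P.run s)
  | .ite b P Q, s => if b.Holds s then P.run s else Q.run s
  | .while _ _, s => s

@[simp] theorem run_skip (s : State) : run .skip s = s := rfl

@[simp] theorem run_assign (x : ℕ) (e : Expr) (s : State) :
    run (.assign x e) s = s.setVar x (e.eval s) := rfl

@[simp] theorem run_put (a : ℕ) (i e : Expr) (s : State) :
    run (.put a i e) s = s.setArr a (i.eval s) (e.eval s) := rfl

@[simp] theorem run_seq (P Q : Prog) (s : State) : run (.seq P Q) s = Q.run (P.run s) := rfl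

theorem run_ite_true {b : Test} {s : State} (h : b.Holds s) (P Q : Prog) :
    run (.ite b P Q) s = P.run s := if_pos h

theorem run_ite_false {b : Test} {s : State} (h : ¬ b.Holds s) (P Q : Prog) :
    run (.ite b P Q) s = Q.run s := if_neg h

/-- Execute the body with the register `x` running from `0` to the value of the register `l`. -/
def forLoop (x l : ℕ) (body : Prog) : Prog :=
  .seq (.assign x (.const 0))
    (.while (.lt (.var x) (.var l)) (.seq body (.assign x (.succ (.var x)))))

end Prog

/-- `s` and `s'` differ at most in what `P` writes. -/
def Frame (P : Prog) (s s' : State) : Prop :=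
  (∀ y ∉ P.vars, s'.var y = s.var y) ∧ ∀ c ∉ P.arrs, s'.arr c = s.arr c

theorem Exec.frame {P : Prog} {s s' : State} {t : ℕ} (h : Exec P s t s') : Frame P s s' := by
  induction h with
  | skip s => exact ⟨fun _ _ => rfl, fun _ _ => rfl⟩
  | assign x e s =>
    refine ⟨fun y hy => ?_, fun _ _ => rfl⟩
    rw [State.setVar_var, if_neg (by simpa [Prog.vars] using hy)]
  | put a i e s =>
    refine ⟨fun _ _ => rfl, fun c hc => funext fun j => ?_⟩
    rw [State.setArr_arr, if_neg fun h => hc (by simp [Prog.arrs, h.1])]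
  | seq _ _ ih1 ih2 =>
    simp only [Frame, Prog.vars, Prog.arrs, List.mem_append, not_or] at *
    exact ⟨fun y hy => (ih2.1 y hy.2).trans (ih1.1 y hy.1),
      fun c hc => (ih2.2 c hc.2).trans (ih1.2 c hc.1)⟩
  | ite_true _ _ ih =>
    simp only [Frame, Prog.vars, Prog.arrs, List.mem_append, not_or] at *
    exact ⟨fun y hy => ih.1 y hy.1, fun c hc => ih.2 c hc.1⟩
  | ite_false _ _ ih =>
    simp only [Frame, Prog.vars, Prog.arrs, List.mem_append, not_or] at *
    exact ⟨fun y hy => ih.1 y hy.2, fun c hc => ih.2 c hc.2⟩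
  | while_true _ _ _ ih1 ih2 =>
    exact ⟨fun y hy => (ih2.1 y hy).trans (ih1.1 y hy),
      fun c hc => (ih2.2 c hc).trans (ih1.2 c hc)⟩
  | while_false _ => exact ⟨fun _ _ => rfl, fun _ _ => rfl⟩

theorem Prog.exec_run {P : Prog} (hP : P.loopFree) (s : State) :
    ∃ t ≤ P.bound, Exec P s t (P.run s) := by
  induction P generalizing s with
  | skip => exact ⟨_, le_rfl, .skip s⟩
  | assign x e => exact ⟨_, le_rfl, .assign x e s⟩
  | put a i e => exact ⟨_, le_rfl, .put a i e s⟩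
  | seq P Q ih1 ih2 =>
    simp only [Prog.loopFree, Bool.and_eq_true] at hP
    obtain ⟨t1, h1, e1⟩ := ih1 hP.1 s
    obtain ⟨t2, h2, e2⟩ := ih2 hP.2 (P.run s)
    exact ⟨_, Nat.add_le_add h1 h2, .seq e1 e2⟩
  | ite b P Q ih1 ih2 =>
    simp only [Prog.loopFree, Bool.and_eq_true] at hP
    by_cases hb : b.Holds s
    · obtain ⟨t1, h1, e1⟩ := ih1 hP.1 s
      rw [Prog.run_ite_true hb]
      refine ⟨b.cost + 1 + t1, by simp only [Prog.bound]; omega, .ite_true hb e1⟩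
    · obtain ⟨t2, h2, e2⟩ := ih2 hP.2 s
      rw [Prog.run_ite_false hb]
      refine ⟨b.cost + 1 + t2, by simp only [Prog.bound]; omega, .ite_false hb e2⟩
  | _ => simp [Prog.loopFree] at hP

/-- Started in `s`, the program halts in a state satisfying `Post` after at most `P.bound * n`
steps. -/
def Runs (n : ℕ) (P : Prog) (s : State) (Post : State → Prop) : Prop :=
  ∃ t s', Exec P s t s' ∧ t ≤ P.bound * n ∧ Post s'

/-! ### Rules for correctness with a time bound -/

variable {n : ℕ} {P Q : Prog} {s : State} {Post Mid : State → Prop}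

theorem Runs.mono (h : Runs n P s Mid) (hPost : ∀ s', Frame P s s' → Mid s' → Post s') :
    Runs n P s Post := by
  obtain ⟨t, s', he, ht, hm⟩ := h
  exact ⟨t, s', he, ht, hPost s' he.frame hm⟩

/-- Since `Prog.bound` is additive, both parts can share the factor `n`. The continuation also
receives the frame, through which facts about untouched cells carry over. -/
theorem Runs.seq (h : Runs n P s Mid) (h' : ∀ s', Frame P s s' → Mid s' → Runs n Q s' Post) :
    Runs n (.seq P Q) s Post := by
  obtain ⟨t, s', he, ht, hm⟩ := h
  obtain ⟨t', s'', he', ht', hm'⟩ := h' s' he.frame hm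
  refine ⟨_, s'', .seq he he', ?_, hm'⟩
  simp only [Prog.bound, Nat.add_mul]
  omega

theorem Runs.of_loopFree (hP : P.loopFree) (hn : 1 ≤ n) (h : Post (P.run s)) :
    Runs n P s Post := by
  obtain ⟨t, ht, he⟩ := Prog.exec_run hP s
  exact ⟨t, _, he, ht.trans (Nat.le_mul_of_pos_right _ hn), h⟩

theorem Runs.ite_true {b : Test} (hb : b.Holds s) (hn : 1 ≤ n) (h : Runs n P s Post) :
    Runs n (.ite b P Q) s Post := by
  obtain ⟨t, s', he, ht, hp⟩ := h
  refine ⟨_, s', .ite_true hb he, ?_, hp⟩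
  have := Nat.le_mul_of_pos_right (b.cost + 1) hn
  simp only [Prog.bound, Nat.add_mul] at this ⊢
  omega

theorem Runs.ite_false {b : Test} (hb : ¬ b.Holds s) (hn : 1 ≤ n) (h : Runs n Q s Post) :
    Runs n (.ite b P Q) s Post := by
  obtain ⟨t, s', he, ht, hp⟩ := h
  refine ⟨_, s', .ite_false hb he, ?_, hp⟩
  have := Nat.le_mul_of_pos_right (b.cost + 1) hn
  simp only [Prog.bound, Nat.add_mul] at this ⊢
  omega

/-- The potential strictly decreases, so there are at most `Φ s` passes, each costing at most one
test and one body; the extra `1` pays for the final failing test. -/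
theorem Runs.loop {b : Test} (hP : P.loopFree) (Inv : State → Prop) (Φ : State → ℕ)
    (h0 : Inv s) (hn : Φ s + 1 ≤ n)
    (step : ∀ s', Frame P s s' → b.Holds s' → Inv s' → Inv (P.run s') ∧ Φ (P.run s') < Φ s')
    (post : ∀ s', Frame P s s' → ¬ b.Holds s' → Inv s' → Post s') :
    Runs n (.while b P) s Post := by
  have key : ∀ k s', Frame P s s' → Inv s' → Φ s' ≤ k → ∃ t s'', Exec (.while b P) s' t s'' ∧
      t ≤ (b.cost + 1 + P.bound) * (k + 1) ∧ Post s'' := by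
    intro k
    induction k with
    | zero =>
      intro s' hf hs hk
      have hb : ¬ b.Holds s' := fun hb => by have := (step s' hf hb hs).2; omega
      exact ⟨_, s', .while_false hb, by omega, post s' hf hb hs⟩
    | succ k ih =>
      intro s' hf hs hk
      by_cases hb : b.Holds s'
      · obtain ⟨t, ht, he⟩ := Prog.exec_run hP s'
        obtain ⟨h1, h2⟩ := step s' hf hb hs
        have hf' : Frame P s (P.run s') := ⟨fun y hy => (he.frame.1 y hy).trans (hf.1 y hy),
          fun c hc => (he.frame.2 c hc).trans (hf.2 c hc)⟩
        obtain ⟨t', s'', he', ht', hp⟩ := ih _ hf' h1 (by omega)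
        refine ⟨_, s'', .while_true hb he he', ?_, hp⟩
        rw [Nat.mul_succ]
        omega
      · exact ⟨_, s', .while_false hb, by rw [Nat.mul_succ]; omega, post s' hf hb hs⟩
  obtain ⟨t, s', he, ht, hp⟩ :=
    key (Φ s) s ⟨fun _ _ => rfl, fun _ _ => rfl⟩ h0 le_rfl
  exact ⟨t, s', he, ht.trans (Nat.mul_le_mul_left _ hn), hp⟩

/-- The syntactic side conditions (loop-free body, counter and limit not assigned by it) are default
arguments decided by computation. -/
theorem Runs.forLoop {x l N : ℕ} {body : Prog} (Inv : ℕ → State → Prop)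
    (hN : s.var l = N) (hn : N + 1 ≤ n) (h0 : Inv 0 (s.setVar x 0))
    (step : ∀ k < N, ∀ s', Frame (Prog.forLoop x l body) s s' → s'.var x = k → Inv k s' →
      Inv (k + 1) ((body.run s').setVar x (k + 1)))
    (post : ∀ s', Frame (Prog.forLoop x l body) s s' → Inv N s' → Post s')
    (hb : body.loopFree := by rfl) (hx : x ∉ body.vars := by decide)
    (hl : l ∉ x :: body.vars := by decide) :
    Runs n (Prog.forLoop x l body) s Post := by
  simp only [List.mem_cons, not_or] at hl
  refine Runs.seq (Mid := fun s' => s' = s.setVar x 0) (.of_loopFree rfl (by omega) rfl) ?_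
  rintro _ - rfl
  have hframe : ∀ s', Frame (.seq body (.assign x (.succ (.var x)))) (s.setVar x 0) s' →
      Frame (Prog.forLoop x l body) s s' := by
    intro s' h
    simp only [Frame, Prog.forLoop, Prog.vars, Prog.arrs, List.mem_append, List.mem_singleton,
      not_or, State.setVar_var, State.setVar_arr] at h ⊢
    refine ⟨fun y hy => ?_, fun c hc => h.2 c hc.2⟩
    have := h.1 y hy.2
    rwa [if_neg hy.1] at this
  have hvl : ∀ s', Frame (.seq body (.assign x (.succ (.var x)))) (s.setVar x 0) s' →
      s'.var l = N := by
    intro s' h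
    have := h.1 l (by simp [Prog.vars, hl.1, hl.2])
    rwa [State.setVar_var, if_neg hl.1, hN] at this
  refine Runs.loop (by simp [Prog.loopFree, hb]) (fun s' => s'.var x ≤ N ∧ Inv (s'.var x) s')
    (fun s' => N - s'.var x) ⟨by simp, by simpa using h0⟩ (by simpa using hn) ?_ ?_
  · rintro s' hf hlt ⟨-, hi⟩
    have hlt' : s'.var x < N := by
      have : s'.var x < s'.var l := hlt
      rwa [hvl s' hf] at this
    obtain ⟨t, -, he⟩ := Prog.exec_run hb s'
    have hxx := he.frame.1 x hx
    have h1 := step _ hlt' s' (hframe s' hf) rfl hi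
    simp only [Prog.run_seq, Prog.run_assign, Expr.eval, hxx, State.setVar_var, if_true]
    exact ⟨⟨by omega, h1⟩, by omega⟩
  · rintro s' hf hlt ⟨hle, hi⟩
    have hlt' : ¬ s'.var x < N := by
      intro h
      exact hlt (show s'.var x < s'.var l by rwa [hvl s' hf])
    exact post s' (hframe s' hf) (by rwa [show s'.var x = N by omega] at hi)

end RAM

namespace TieInstance

/-! ## The concatenated adjacency lists -/

section Entries

variable {n n' : ℕ} {L : Fin n → List (List (Fin n'))}

theorem mem_entries {α β : Type} {vs : List α} {L : α → List (List β)} {r : α × β × ℕ} :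
    r ∈ entries vs L ↔ r.1 ∈ vs ∧ ∃ tie, (L r.1)[r.2.2]? = some tie ∧ r.2.1 ∈ tie := by
  obtain ⟨v, u, i⟩ := r
  simp only [entries, List.mem_flatMap, List.mem_map, Prod.exists, List.mem_zipIdx_iff_getElem?,
    Prod.mk.injEq]
  constructor
  · rintro ⟨v', hv, tie, i', h, u', hu, rfl, rfl, rfl⟩
    exact ⟨hv, tie, h, hu⟩
  · rintro ⟨hv, tie, h, hu⟩
    exact ⟨v, hv, tie, i, h, u, hu, rfl, rfl, rfl⟩

/-- Ties are disjoint, so the tie from which an entry comes is the first one containing its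
neighbour. Thus the stored indices are the ranks. -/
theorem findIdx_of_mem_entries (hL : ∀ v, (L v).flatten.Nodup) {vs : List (Fin n)}
    {r : Fin n × Fin n' × ℕ} (hr : r ∈ entries vs L) :
    (L r.1).findIdx (fun tie => decide (r.2.1 ∈ tie)) = r.2.2 := by
  obtain ⟨-, tie, h, hu⟩ := mem_entries.1 hr
  obtain ⟨hlt, rfl⟩ := List.getElem?_eq_some_iff.1 h
  rw [List.findIdx_eq hlt]
  refine ⟨by simpa using hu, fun j hj => ?_⟩
  have := List.pairwise_iff_getElem.1 (List.nodup_flatten.1 (hL r.1)).2 j r.2.2 (by omega) hlt hj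
  simpa using fun h => this h hu

theorem mem_flatten_of_mem_entries {vs : List (Fin n)} {r : Fin n × Fin n' × ℕ}
    (hr : r ∈ entries vs L) : r.2.1 ∈ (L r.1).flatten := by
  obtain ⟨-, tie, h, hu⟩ := mem_entries.1 hr
  exact List.mem_flatten.2 ⟨tie, List.mem_of_getElem? h, hu⟩

theorem exists_mem_entries {v : Fin n} {u : Fin n'} (h : u ∈ (L v).flatten) :
    ∃ r ∈ entries (List.finRange n) L, r.1 = v ∧ r.2.1 = u := by
  obtain ⟨tie, ht, hu⟩ := List.mem_flatten.1 h
  obtain ⟨i, hi⟩ := List.mem_iff_getElem?.1 ht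
  exact ⟨(v, u, i), mem_entries.2 ⟨List.mem_finRange v, tie, hi, hu⟩, rfl, rfl⟩

/-- All order properties used later come from here: entries are grouped by vertex in increasing
order, and within one vertex the ranks ascend and no neighbour repeats. -/
theorem pairwise_entries (hL : ∀ v, (L v).flatten.Nodup) :
    (entries (List.finRange n) L).Pairwise fun x y =>
      x.1 ≤ y.1 ∧ (x.1 = y.1 → x.2.2 ≤ y.2.2 ∧ x.2.1 ≠ y.2.1) := by
  rw [entries, List.pairwise_flatMap]
  constructor
  · intro v _
    obtain ⟨h1, h2⟩ := List.nodup_flatten.1 (hL v)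
    rw [List.pairwise_flatMap]
    constructor
    · rintro ⟨tie, i⟩ hi
      have htie : tie.Nodup := h1 _ (List.mem_of_getElem? (List.mem_zipIdx_iff_getElem?.1 hi))
      rw [List.pairwise_map]
      exact htie.imp fun h => ⟨le_rfl, fun _ => ⟨le_rfl, h⟩⟩
    · rw [List.pairwise_iff_getElem]
      intro i j hi hj hij x hx y hy
      simp only [List.getElem_zipIdx, List.mem_map] at hx hy
      obtain ⟨u, hu, rfl⟩ := hx
      obtain ⟨u', hu', rfl⟩ := hy
      rw [List.length_zipIdx] at hi hj
      have := List.pairwise_iff_getElem.1 h2 i j hi hj hij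
      refine ⟨le_rfl, fun _ => ⟨by simp only; omega, fun h => ?_⟩⟩
      obtain rfl : u = u' := h
      exact this hu hu'
  · refine List.Pairwise.imp ?_ (List.pairwise_lt_finRange n)
    intro a b hab x hx y hy
    simp only [List.mem_flatMap, List.mem_map] at hx hy
    obtain ⟨_, _, _, _, rfl⟩ := hx
    obtain ⟨_, _, _, _, rfl⟩ := hy
    exact ⟨le_of_lt hab, fun h => absurd h (ne_of_lt hab)⟩

end Entries

/-! ### Enumerations of the edges along both families of lists -/

section Listing

variable {p q : ℕ} (I : TieInstance p q)

/-- The two concatenated adjacency lists enumerate the `N` edges by `f` and by `g`. -/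
structure Listing (N : ℕ) (f g : ℕ → Fin p × Fin q) : Prop where
  inj : ∀ k < N, ∀ l < N, f k = f l → k = l
  mem : ∀ k < N, f k ∈ I.edges
  exists_eq : ∀ e ∈ I.edges, ∃ k < N, f k = e
  man_le : ∀ k l, k ≤ l → l < N → (f k).1 ≤ (f l).1
  rank_le : ∀ k l, k ≤ l → l < N → (f k).1 = (f l).1 →
    I.menRank (f k).1 (f k).2 ≤ I.menRank (f k).1 (f l).2
  mem' : ∀ j < N, g j ∈ I.edges
  exists_eq' : ∀ e ∈ I.edges, ∃ j < N, g j = e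
  woman_le : ∀ j l, j ≤ l → l < N → (g j).2 ≤ (g l).2

/-- The memory holds the adjacency lists enumerated by `f` and `g`. -/
structure HasInput (N : ℕ) (f g : ℕ → Fin p × Fin q) (s : RAM.State) : Prop where
  arr0 : ∀ k < N, s.arr 0 k = (f k).1
  arr1 : ∀ k < N, s.arr 1 k = (f k).2
  arr2 : ∀ k < N, s.arr 2 k = I.menRank (f k).1 (f k).2
  arr3 : ∀ k < N, s.arr 3 k = (g k).2
  arr4 : ∀ k < N, s.arr 4 k = (g k).1
  arr5 : ∀ k < N, s.arr 5 k = I.womenRank (g k).2 (g k).1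

variable (m : Fin p) (w : Fin q)

/-- The edge at position `k` of the men's lists. -/
def menEnum (k : ℕ) : Fin p × Fin q :=
  (I.menEntries.map fun r => (r.1, r.2.1)).getD k (m, w)

/-- The edge at position `k` of the women's lists. -/
def womenEnum (k : ℕ) : Fin p × Fin q :=
  (I.womenEntries.map fun r => (r.2.1, r.1)).getD k (m, w)

variable {I m w}

theorem mem_edges {e : Fin p × Fin q} : e ∈ I.edges ↔ e.2 ∈ (I.menLists e.1).flatten := by
  simp [edges]

theorem length_menEntries : I.menEntries.length = I.edges.card := by
  have hn : (I.menEntries.map fun r => (r.1, r.2.1)).Nodup := by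
    rw [List.Nodup, List.pairwise_map]
    refine (pairwise_entries I.men_nodup).imp fun h he => ?_
    exact (h.2 (Prod.mk.inj he).1).2 (Prod.mk.inj he).2
  rw [← List.length_map (f := fun r : Fin p × Fin q × ℕ => (r.1, r.2.1)),
    ← List.toFinset_card_of_nodup hn]
  congr 1
  ext ⟨a, b⟩
  rw [List.mem_toFinset, mem_edges, List.mem_map]
  constructor
  · rintro ⟨r, hr, he⟩
    have := mem_flatten_of_mem_entries hr
    obtain ⟨rfl, rfl⟩ := Prod.mk.inj he
    exact this
  · intro h
    obtain ⟨r, hr, h1, h2⟩ := exists_mem_entries h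
    exact ⟨r, hr, Prod.ext h1 h2⟩

theorem length_womenEntries : I.womenEntries.length = I.edges.card := by
  have hn : (I.womenEntries.map fun r => (r.2.1, r.1)).Nodup := by
    rw [List.Nodup, List.pairwise_map]
    refine (pairwise_entries I.women_nodup).imp fun h he => ?_
    exact (h.2 (Prod.mk.inj he).2).2 (Prod.mk.inj he).1
  rw [← List.length_map (f := fun r : Fin q × Fin p × ℕ => (r.2.1, r.1)),
    ← List.toFinset_card_of_nodup hn]
  congr 1
  ext ⟨a, b⟩
  rw [List.mem_toFinset, mem_edges, List.mem_map, I.mem_iff]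
  constructor
  · rintro ⟨r, hr, he⟩
    have := mem_flatten_of_mem_entries hr
    obtain ⟨rfl, rfl⟩ := Prod.mk.inj he
    exact this
  · intro h
    obtain ⟨r, hr, h1, h2⟩ := exists_mem_entries h
    exact ⟨r, hr, Prod.ext h2 h1⟩

theorem menEnum_eq {k : ℕ} (hk : k < I.menEntries.length) :
    I.menEnum m w k = (I.menEntries[k].1, I.menEntries[k].2.1) := by
  simp [menEnum, List.getD_eq_getElem?_getD, hk]

theorem womenEnum_eq {k : ℕ} (hk : k < I.womenEntries.length) :
    I.womenEnum m w k = (I.womenEntries[k].2.1, I.womenEntries[k].1) := by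
  simp [womenEnum, List.getD_eq_getElem?_getD, hk]

theorem listing : I.Listing I.edges.card (I.menEnum m w) (I.womenEnum m w) := by
  have pm := List.pairwise_iff_getElem.1 (pairwise_entries I.men_nodup)
  have pw := List.pairwise_iff_getElem.1 (pairwise_entries I.women_nodup)
  constructor
  · rw [← length_menEntries]
    intro k hk l hl h
    rw [menEnum_eq hk, menEnum_eq hl] at h
    obtain ⟨h1, h2⟩ := Prod.mk.inj h
    rcases lt_trichotomy k l with hkl | rfl | hkl
    · exact absurd h2 ((pm k l hk hl hkl).2 h1).2
    · rfl
    · exact absurd h2.symm ((pm l k hl hk hkl).2 h1.symm).2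
  · rw [← length_menEntries]
    intro k hk
    rw [menEnum_eq hk, mem_edges]
    exact mem_flatten_of_mem_entries (List.getElem_mem hk)
  · rw [← length_menEntries]
    rintro ⟨a, b⟩ he
    obtain ⟨r, hr, h1, h2⟩ := exists_mem_entries (mem_edges.1 he)
    obtain ⟨k, hk, rfl⟩ := List.mem_iff_getElem.1 hr
    exact ⟨k, hk, (menEnum_eq hk).trans (Prod.ext h1 h2)⟩
  · rw [← length_menEntries]
    intro k l hkl hl
    rcases hkl.eq_or_lt with rfl | hkl
    · exact le_rfl
    rw [menEnum_eq hl, menEnum_eq (hkl.trans hl)]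
    exact (pm k l _ hl hkl).1
  · rw [← length_menEntries]
    intro k l hkl hl h
    rcases hkl.eq_or_lt with rfl | hkl
    · exact le_rfl
    rw [menEnum_eq hl, menEnum_eq (hkl.trans hl)] at h ⊢
    have : I.menEntries[k].2.2 ≤ I.menEntries[l].2.2 := ((pm k l (hkl.trans hl) hl hkl).2 h).1
    rw [← findIdx_of_mem_entries I.men_nodup (List.getElem_mem hl),
      ← findIdx_of_mem_entries I.men_nodup (List.getElem_mem (hkl.trans hl))] at this
    simp only at h
    simp only [menRank]
    rw [← h] at this
    exact this
  · rw [← length_womenEntries]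
    intro k hk
    rw [womenEnum_eq hk, mem_edges, I.mem_iff]
    exact mem_flatten_of_mem_entries (List.getElem_mem hk)
  · rw [← length_womenEntries]
    rintro ⟨a, b⟩ he
    obtain ⟨r, hr, h1, h2⟩ := exists_mem_entries ((I.mem_iff a b).1 (mem_edges.1 he))
    obtain ⟨k, hk, rfl⟩ := List.mem_iff_getElem.1 hr
    exact ⟨k, hk, (womenEnum_eq hk).trans (Prod.ext h2 h1)⟩
  · rw [← length_womenEntries]
    intro k l hkl hl
    rcases hkl.eq_or_lt with rfl | hkl
    · exact le_rfl
    rw [womenEnum_eq hl, womenEnum_eq (hkl.trans hl)]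
    exact (pw k l _ hl hkl).1

theorem hasInput : I.HasInput I.edges.card (I.menEnum m w) (I.womenEnum m w) (I.inputState m w) := by
  constructor
  iterate 3
    rw [← length_menEntries]
    intro k hk
    rw [menEnum_eq hk]
    simp [inputState, List.getD_eq_getElem?_getD, hk, menRank,
      ← findIdx_of_mem_entries I.men_nodup (List.getElem_mem hk)]
  iterate 3
    rw [← length_womenEntries]
    intro k hk
    rw [womenEnum_eq hk]
    simp [inputState, List.getD_eq_getElem?_getD, hk, womenRank,
      ← findIdx_of_mem_entries I.women_nodup (List.getElem_mem hk)]

theorem HasInput.of_arr_eq {N : ℕ} {f g : ℕ → Fin p × Fin q} {s s' : RAM.State}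
    (h : I.HasInput N f g s) (hs : ∀ c < 6, s'.arr c = s.arr c) : I.HasInput N f g s' := by
  obtain ⟨h0, h1, h2, h3, h4, h5⟩ := h
  rw [← hs _ (by decide)] at h0 h1 h2 h3 h4 h5
  exact ⟨h0, h1, h2, h3, h4, h5⟩

end Listing

end TieInstance

namespace TieInstance

open RAM

/-! ## First phase: the reduced graph -/

section Reduce

variable {p q N : ℕ} {I : TieInstance p q} {f g : ℕ → Fin p × Fin q}

/-- For every position `k` of the men's lists, array `10` points to the preceding position with the
same woman, and array `11` points to the last position of each woman (pointers are shifted by one,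
`0` is the null pointer). -/
def linkProg : Prog :=
  .forLoop 6 5 (.seq (.put 10 (.var 6) (.get 11 (.get 1 (.var 6))))
    (.put 11 (.get 1 (.var 6)) (.succ (.var 6))))

/-- `h` points to the last position below `i` of the woman `b`. -/
def PointsToLast (f : ℕ → Fin p × Fin q) (i h : ℕ) (b : Fin q) : Prop :=
  h ≤ i ∧ (∀ k < i, (f k).2 = b → k < h) ∧ (h = 0 ∨ (f (h - 1)).2 = b)

theorem runs_linkProg {s : State} (hs : I.HasInput N f g s) (h5 : s.var 5 = N)
    (h11 : ∀ b, s.arr 11 b = 0) {n : ℕ} (hn : N + 1 ≤ n) :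
    Runs n linkProg s fun s' =>
      (∀ k < N, PointsToLast f k (s'.arr 10 k) (f k).2) ∧
        ∀ b : Fin q, PointsToLast f N (s'.arr 11 b) b := by
  refine Runs.forLoop (fun i s' => (∀ k < i, PointsToLast f k (s'.arr 10 k) (f k).2) ∧
    ∀ b : Fin q, PointsToLast f i (s'.arr 11 b) b) h5 hn ⟨by simp, fun b => ?_⟩ ?_
    fun s' _ h => h
  · simp [PointsToLast, h11]
  · rintro k hk s' hf hx ⟨h1, h2⟩
    have hw : s'.arr 1 k = (f k).2 := by rw [hf.2 1 (by decide), hs.arr1 k hk]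
    simp only [Prog.run_seq, Prog.run_put, Expr.eval, State.setVar_arr, State.setArr_self,
      State.setArr_ne, State.setArr_var, hx, hw, ne_eq, not_false_eq_true,
      Nat.reduceEqDiff, Fin.val_inj]
    refine ⟨fun l hl => ?_, fun b => ?_⟩
    · rcases Nat.lt_succ_iff_lt_or_eq.1 hl with hl | rfl
      · simpa [hl.ne] using h1 l hl
      · simpa using h2 _
    · by_cases hb : b = (f k).2
      · subst hb
        simpa [PointsToLast] using fun l hl _ => by omega
      · obtain ⟨h3, h4, h5⟩ := h2 b
        rw [if_neg hb]
        refine ⟨by omega, fun l hl hlb => ?_, h5⟩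
        rcases Nat.lt_succ_iff_lt_or_eq.1 hl with hl | rfl
        · exact h4 l hl hlb
        · exact absurd hlb.symm hb

/-- Copies to array `12` at each position of the men's lists the rank of the man in the woman's
list.  For each woman, her positions in the men's lists are first recorded in array `13`. -/
def crossProg : Prog :=
  .seq (.assign 6 (.const 0))
    (.while (.lt (.var 6) (.var 5))
      (.ite (.lt (.const 0) (.get 11 (.get 3 (.var 6))))
        (.seq (.put 13 (.get 0 (.pred (.get 11 (.get 3 (.var 6)))))
            (.pred (.get 11 (.get 3 (.var 6)))))
          (.put 11 (.get 3 (.var 6)) (.get 10 (.pred (.get 11 (.get 3 (.var 6)))))))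
        (.seq (.put 12 (.get 13 (.get 4 (.var 6))) (.get 5 (.var 6)))
          (.assign 6 (.succ (.var 6))))))

/-- The state of `crossProg` at the position `j` of the women's lists. -/
structure CrossInv (I : TieInstance p q) (N : ℕ) (f g : ℕ → Fin p × Fin q) (j : ℕ)
    (s : State) : Prop where
  le : j ≤ N
  head : ∀ b : Fin q, s.arr 11 b ≤ N ∧ (s.arr 11 b = 0 ∨ (f (s.arr 11 b - 1)).2 = b)
  -- The three stages of an edge: its rank has been copied; its position is still in the linked list
  -- of its woman; or her list is being unpacked and its position is recorded under its man.
  cases : ∀ k < N, ∀ i < N, g i = f k →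
    i < j ∧ s.arr 12 k = I.womenRank (f k).2 (f k).1 ∨
    j ≤ i ∧ k < s.arr 11 (f k).2 ∨
    j ≤ i ∧ (g j).2 = (f k).2 ∧ s.arr 13 (f k).1 = k

/-- Array `13` is never cleared. An entry of it is read only once the linked list of the current
woman is exhausted, and then the cells of all her neighbours hold positions of her own edges. -/
theorem runs_crossProg (hl : I.Listing N f g) {s : State} (hs : I.HasInput N f g s)
    (h5 : s.var 5 = N) (h10 : ∀ k < N, PointsToLast f k (s.arr 10 k) (f k).2)
    (h11 : ∀ b : Fin q, PointsToLast f N (s.arr 11 b) b) {n : ℕ} (hn : 2 * N + 1 ≤ n) :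
    Runs n crossProg s fun s' => ∀ k < N, s'.arr 12 k = I.womenRank (f k).2 (f k).1 := by
  refine Runs.seq (Mid := fun s' => s' = s.setVar 6 0) (.of_loopFree rfl (by omega) rfl) ?_
  rintro _ - rfl
  refine Runs.loop rfl (fun s' => CrossInv I N f g (s'.var 6) s')
    -- Each pass either advances in the women's lists or moves a head back past at least one
    -- position; both summands are at most `N`.
    (fun s' => (N - s'.var 6) + ((Finset.range N).filter fun k => k < s'.arr 11 (f k).2).card)
    ?_ ?_ ?_ ?_
  · refine ⟨by simp, fun b => ⟨(h11 b).1, (h11 b).2.2⟩, fun k hk i hi hik => .inr (.inl ?_)⟩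
    exact ⟨by simp, (h11 _).2.1 k hk rfl⟩
  · have := (Finset.card_filter_le (Finset.range N)
      fun k => k < (s.setVar 6 0).arr 11 (f k).2)
    rw [Finset.card_range] at this
    simp only [State.setVar_self]
    omega
  · intro s' hf hlt hinv
    have v5 : s'.var 5 = N := by rw [hf.1 5 (by decide)]; simpa using h5
    have a0 : ∀ k < N, s'.arr 0 k = (f k).1 := by rw [hf.2 0 (by decide)]; exact hs.arr0
    have a3 : ∀ k < N, s'.arr 3 k = (g k).2 := by rw [hf.2 3 (by decide)]; exact hs.arr3
    have a4 : ∀ k < N, s'.arr 4 k = (g k).1 := by rw [hf.2 4 (by decide)]; exact hs.arr4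
    have a5 : ∀ k < N, s'.arr 5 k = I.womenRank (g k).2 (g k).1 := by
      rw [hf.2 5 (by decide)]; exact hs.arr5
    have a10 : s'.arr 10 = s.arr 10 := hf.2 10 (by decide)
    obtain ⟨j, hj⟩ : ∃ j, s'.var 6 = j := ⟨_, rfl⟩
    have hjN : j < N := by
      have : s'.var 6 < s'.var 5 := hlt
      omega
    rw [hj] at hinv
    obtain ⟨b, hb⟩ : ∃ b, (g j).2 = b := ⟨_, rfl⟩
    have a3j : s'.arr 3 j = b := by rw [a3 j hjN, hb]
    by_cases h0 : 0 < s'.arr 11 b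
    · obtain ⟨k₀, hk₀⟩ : ∃ k₀, s'.arr 11 b = k₀ + 1 := ⟨s'.arr 11 b - 1, by omega⟩
      have hb₀ := hinv.head b
      rw [hk₀] at hb₀
      have hk₀N : k₀ < N := hb₀.1
      have hfk₀ : (f k₀).2 = b := by simpa using hb₀.2
      obtain ⟨n1, n2, n3⟩ := h10 k₀ hk₀N
      rw [Prog.run_ite_true (by simpa [Test.Holds, Expr.eval, hj, a3j] using h0)]
      simp only [Prog.run_seq, Prog.run_put, Expr.eval, State.setArr_var, hj,
        a3j, hk₀, Nat.add_sub_cancel, a0 k₀ hk₀N, a10, State.setArr_self, State.setArr_ne, ne_eq,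
        Nat.reduceEqDiff, not_false_eq_true, Fin.val_inj]
      constructor
      · refine ⟨hjN.le, fun b' => ?_, fun k hk i hi hik => ?_⟩
        · simp only [State.setArr_self, State.setArr_ne, ne_eq, Nat.reduceEqDiff,
            not_false_eq_true, Fin.val_inj]
          split_ifs with hbb
          · subst hbb
            refine ⟨by omega, ?_⟩
            rw [← hfk₀]
            exact n3
          · exact hinv.head b'
        · simp only [State.setArr_self, State.setArr_ne, ne_eq, Nat.reduceEqDiff,
            not_false_eq_true, Fin.val_inj]
          rcases hinv.cases k hk i hi hik with h | ⟨h1, h2⟩ | ⟨h1, h2, h3⟩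
          · exact .inl h
          · by_cases hkb : (f k).2 = b
            · rw [hkb, hk₀] at h2
              rcases Nat.lt_succ_iff_lt_or_eq.1 h2 with h2 | rfl
              · refine .inr (.inl ⟨h1, ?_⟩)
                rw [if_pos hkb]
                exact n2 k h2 (hkb.trans hfk₀.symm)
              · exact .inr (.inr ⟨h1, hb.trans hkb.symm, by simp⟩)
            · refine .inr (.inl ⟨h1, ?_⟩)
              rwa [if_neg hkb]
          · by_cases hkk : k = k₀
            · subst hkk
              exact .inr (.inr ⟨h1, h2, by simp⟩)
            · refine .inr (.inr ⟨h1, h2, ?_⟩)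
              -- Writing position `k₀` destroys no other record: `k` and `k₀` have the same woman,
              -- so if they had the same man they would be the same edge.
              rw [if_neg, h3]
              intro h
              refine hkk (hl.inj k hk k₀ hk₀N (Prod.ext h ?_))
              rw [hfk₀, ← hb, h2]
      · refine Nat.add_lt_add_left (Finset.card_lt_card ?_) _
        rw [Finset.ssubset_iff_of_subset]
        · refine ⟨k₀, ?_, ?_⟩
          · simp [hk₀N, hfk₀, hk₀]
          · simp [hfk₀, n1]
        · intro k hk
          simp only [Finset.mem_filter, Finset.mem_range] at hk ⊢
          refine ⟨hk.1, ?_⟩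
          have := hk.2
          split_ifs at this with hkb
          · rw [hkb, hk₀]; omega
          · exact this
    · have h0' : s'.arr 11 b = 0 := by omega
      rw [Prog.run_ite_false (by simpa [Test.Holds, Expr.eval, hj, a3j] using h0')]
      simp only [Prog.run_seq, Prog.run_put, Prog.run_assign, Expr.eval, State.setArr_ne,
        State.setArr_var, State.setVar_self, State.setVar_arr, hj, ne_eq,
        Nat.reduceEqDiff, not_false_eq_true]
      refine ⟨⟨hjN, fun b => by simpa using hinv.head b, fun k hk i hi hik => ?_⟩, by omega⟩
      simp only [State.setArr_self, State.setArr_ne, State.setVar_arr, a4 j hjN, a5 j hjN, ne_eq,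
        Nat.reduceEqDiff, not_false_eq_true]
      rcases hinv.cases k hk i hi hik with ⟨h1, h2⟩ | ⟨h1, h2⟩ | ⟨h1, h2, h3⟩
      · refine .inl ⟨by omega, ?_⟩
        split_ifs with hc
        · obtain ⟨k', hk', he⟩ := hl.exists_eq _ (hl.mem' j hjN)
          obtain ⟨i', hi', he'⟩ := hl.exists_eq' _ (hl.mem k hk)
          -- the position recorded for the current man is the current edge
          rcases hinv.cases k' hk' j hjN he.symm with ⟨h3, -⟩ | ⟨-, h4⟩ | ⟨-, -, h5⟩
          · omega
          · rw [he, hb, h0'] at h4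
            omega
          · rw [he, ← hc] at h5
            rw [← he, h5]
        · exact h2
      · have hij : j ≠ i := by
          rintro rfl
          rw [← hik, hb, h0'] at h2
          omega
        exact .inr (.inl ⟨by omega, h2⟩)
      · rcases h1.eq_or_lt with rfl | h1
        · refine .inl ⟨by omega, ?_⟩
          rw [hik, if_pos h3.symm]
        · refine .inr (.inr ⟨h1, ?_, h3⟩)
          -- The women's lists are grouped by woman, so the position after `j`, which is at most
          -- `i`, still belongs to the woman of both.
          refine le_antisymm ?_ ?_
          · rw [← hik]
            exact hl.woman_le _ _ h1 hi
          · rw [← h2]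
            exact hl.woman_le _ _ (by omega) (by omega)
  · intro s' hf hlt hinv k hk
    have v5 : s'.var 5 = N := by rw [hf.1 5 (by decide)]; simpa using h5
    have hlt' : N ≤ s'.var 6 := by
      have : ¬ s'.var 6 < s'.var 5 := hlt
      omega
    obtain ⟨i, hi, he⟩ := hl.exists_eq' _ (hl.mem k hk)
    rcases hinv.cases k hk i hi he with h | h | h
    · exact h.2
    · omega
    · omega

end Reduce

end TieInstance

namespace TieInstance

open RAM

/-! ### Thresholds given by the fixed edge, and the surviving edges -/

section Reduce

variable {p q N : ℕ} {I : TieInstance p q} {f g : ℕ → Fin p × Fin q} {m : Fin p} {w : Fin q}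

variable (I N f) in
/-- Arrays `0`, `1`, `2`, `12` hold the edges in the order of `f`, with their ranks for the men and
for the women. -/
structure HasEdges (s : State) : Prop where
  var5 : s.var 5 = N
  arr0 : ∀ k < N, s.arr 0 k = (f k).1
  arr1 : ∀ k < N, s.arr 1 k = (f k).2
  arr2 : ∀ k < N, s.arr 2 k = I.menRank (f k).1 (f k).2
  arr12 : ∀ k < N, s.arr 12 k = I.womenRank (f k).2 (f k).1

theorem HasEdges.of_frame {s s' : State} (h : I.HasEdges N f s) {P : Prog} (hf : Frame P s s')
    (h5 : 5 ∉ P.vars := by decide) (hP : ∀ c ∈ [0, 1, 2, 12], c ∉ P.arrs := by decide) :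
    I.HasEdges N f s' := by
  simp only [List.mem_cons, List.not_mem_nil, or_false, forall_eq_or_imp, forall_eq] at hP
  obtain ⟨h1, h2, h3, h4, h5'⟩ := h
  rw [← hf.2 0 hP.1] at h2
  rw [← hf.2 1 hP.2.1] at h3
  rw [← hf.2 2 hP.2.2.1] at h4
  rw [← hf.2 12 hP.2.2.2] at h5'
  exact ⟨(hf.1 5 h5).trans h1, h2, h3, h4, h5'⟩

/-- The cell content `x` records the value `v` if `P` holds, and nothing otherwise. -/
def Records (P : Prop) (v x : ℕ) : Prop := P ∧ x = v + 1 ∨ ¬ P ∧ x = 0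

/-- Loads the ranks of the fixed edge into the registers `7` and `8`. -/
def rankProg : Prog :=
  .forLoop 6 5 (.ite (.and (.eq (.get 0 (.var 6)) (.var 1)) (.eq (.get 1 (.var 6)) (.var 2)))
    (.seq (.assign 7 (.get 2 (.var 6))) (.assign 8 (.get 12 (.var 6)))) .skip)

theorem runs_rankProg (hl : I.Listing N f g) (hmw : (m, w) ∈ I.edges) {s : State}
    (hs : I.HasEdges N f s) (h1 : s.var 1 = m) (h2 : s.var 2 = w) {n : ℕ} (hn : N + 1 ≤ n) :
    Runs n rankProg s fun s' => s'.var 7 = I.menRank m w ∧ s'.var 8 = I.womenRank w m := by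
  refine Runs.forLoop (fun i s' => (∃ k < i, f k = (m, w)) →
    s'.var 7 = I.menRank m w ∧ s'.var 8 = I.womenRank w m) hs.var5 hn (by simp) ?_
    fun s' _ h => h (hl.exists_eq _ hmw)
  intro k hk s' hf hx hi
  have hs' := hs.of_frame hf
  have v1 : s'.var 1 = m := by rw [hf.1 1 (by decide), h1]
  have v2 : s'.var 2 = w := by rw [hf.1 2 (by decide), h2]
  by_cases he : f k = (m, w)
  · intro _
    rw [Prog.run_ite_true (by simp [Test.Holds, Expr.eval, hx, hs'.arr0 k hk, hs'.arr1 k hk, v1, v2,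
      he])]
    simp [Expr.eval, hx, hs'.arr2 k hk, hs'.arr12 k hk, he]
  · rintro ⟨l, hl, hle⟩
    rcases Nat.lt_succ_iff_lt_or_eq.1 hl with hl | rfl
    · rw [Prog.run_ite_false (by simpa [Test.Holds, Expr.eval, hx, hs'.arr0 k hk, hs'.arr1 k hk, v1,
        v2, Fin.val_inj, Prod.ext_iff] using he)]
      simpa using hi ⟨l, hl, hle⟩
    · exact absurd hle he

/-- Records in array `14` for every man `a` whom `w` weakly prefers to `m` his rank of `w`, and in
array `15` for every woman `b` whom `m` weakly prefers to `w` her rank of `m`. -/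
def thresholdProg : Prog :=
  .forLoop 6 5 (.seq
    (.ite (.and (.eq (.get 1 (.var 6)) (.var 2)) (.not (.lt (.var 8) (.get 12 (.var 6)))))
      (.put 14 (.get 0 (.var 6)) (.succ (.get 2 (.var 6)))) .skip)
    (.ite (.and (.eq (.get 0 (.var 6)) (.var 1)) (.not (.lt (.var 7) (.get 2 (.var 6)))))
      (.put 15 (.get 1 (.var 6)) (.succ (.get 12 (.var 6)))) .skip))

/-- All deletions that `w` causes at a man depend on a single number, his rank of `w`, and likewise
for `m` and the women. One cell per vertex therefore makes the later test of an edge take constant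
time. -/
theorem runs_thresholdProg (hl : I.Listing N f g) {s : State}
    (hs : I.HasEdges N f s) (h1 : s.var 1 = m) (h2 : s.var 2 = w) (h7 : s.var 7 = I.menRank m w)
    (h8 : s.var 8 = I.womenRank w m) (h14 : ∀ x, s.arr 14 x = 0) (h15 : ∀ x, s.arr 15 x = 0)
    {n : ℕ} (hn : N + 1 ≤ n) :
    Runs n thresholdProg s fun s' =>
      (∀ a : Fin p, Records ((a, w) ∈ I.edges ∧ I.womanPrefers w a m) (I.menRank a w)
        (s'.arr 14 a)) ∧
      ∀ b : Fin q, Records ((m, b) ∈ I.edges ∧ I.manPrefers m b w) (I.womenRank b m)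
        (s'.arr 15 b) := by
  have hex : ∀ e, e ∈ I.edges ↔ ∃ k < N, f k = e := fun e =>
    ⟨hl.exists_eq e, by rintro ⟨k, hk, rfl⟩; exact hl.mem k hk⟩
  simp only [hex]
  refine Runs.forLoop (fun i s' =>
    (∀ a : Fin p, Records ((∃ k < i, f k = (a, w)) ∧ I.womanPrefers w a m) (I.menRank a w)
      (s'.arr 14 a)) ∧
    ∀ b : Fin q, Records ((∃ k < i, f k = (m, b)) ∧ I.manPrefers m b w) (I.womenRank b m)
      (s'.arr 15 b)) hs.var5 hn (by simp [Records, h14, h15]) ?_ fun s' _ h => h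
  rintro k hk s' hf hx ⟨i1, i2⟩
  have hs' := hs.of_frame hf
  have v1 : s'.var 1 = m := by rw [hf.1 1 (by decide), h1]
  have v2 : s'.var 2 = w := by rw [hf.1 2 (by decide), h2]
  have v7 : s'.var 7 = I.menRank m w := by rw [hf.1 7 (by decide), h7]
  have v8 : s'.var 8 = I.womenRank w m := by rw [hf.1 8 (by decide), h8]
  have hsucc : ∀ e, (∃ l < k + 1, f l = e) ↔ (∃ l < k, f l = e) ∨ f k = e := by
    intro e
    constructor
    · rintro ⟨l, hl, h⟩
      rcases Nat.lt_succ_iff_lt_or_eq.1 hl with hl | rfl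
      exacts [.inl ⟨l, hl, h⟩, .inr h]
    · rintro (⟨l, hl, h⟩ | h)
      exacts [⟨l, by omega, h⟩, ⟨k, by omega, h⟩]
  simp only [hsucc, Prog.run_seq, State.setVar_arr]
  obtain ⟨x, y, hxy⟩ : ∃ x y, f k = (x, y) := ⟨_, _, rfl⟩
  have b0 := hs'.arr0 k hk
  have b1 := hs'.arr1 k hk
  have b2 := hs'.arr2 k hk
  have b12 := hs'.arr12 k hk
  rw [hxy] at b0 b1 b2 b12
  simp only [hxy, Prod.mk.injEq]
  -- the state after the first conditional
  obtain ⟨s₁, hs₁⟩ : ∃ s₁, Prog.run (.ite (.and (.eq (.get 1 (.var 6)) (.var 2))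
      (.not (.lt (.var 8) (.get 12 (.var 6)))))
      (.put 14 (.get 0 (.var 6)) (.succ (.get 2 (.var 6)))) .skip) s' = s₁ := ⟨_, rfl⟩
  have hs₁' : (∀ a : Fin p, Records (((∃ l < k, f l = (a, w)) ∨ x = a ∧ y = w) ∧
      I.womanPrefers w a m) (I.menRank a w) (s₁.arr 14 a)) ∧ s₁.var = s'.var ∧
      ∀ c ≠ 14, s₁.arr c = s'.arr c := by
    rw [← hs₁]
    by_cases hc : y = w ∧ I.womanPrefers w x m
    · obtain ⟨rfl, hp⟩ := hc
      rw [Prog.run_ite_true (by simpa [Test.Holds, Expr.eval, hx, b1, b12, v2, v8, womanPrefers] using hp)]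
      refine ⟨fun a => ?_, rfl, fun c hc => funext fun j => by simp [hc]⟩
      simp only [Prog.run_put, Expr.eval, hx, b0, b2, State.setArr_self, Fin.val_inj]
      by_cases hax : a = x
      · subst hax
        simp [Records, hp]
      · simpa [hax, Ne.symm hax] using i1 a
    · rw [Prog.run_ite_false (by
        simpa [Test.Holds, Expr.eval, hx, b1, b12, v2, v8, Fin.val_inj, womanPrefers]
          using fun h => by subst h; simpa [womanPrefers] using hc)]
      refine ⟨fun a => ?_, rfl, fun c hc => rfl⟩
      have : ((∃ l < k, f l = (a, w)) ∨ x = a ∧ y = w) ∧ I.womanPrefers w a m ↔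
          (∃ l < k, f l = (a, w)) ∧ I.womanPrefers w a m := by
        constructor
        · rintro ⟨h | ⟨rfl, rfl⟩, h'⟩
          exacts [⟨h, h'⟩, absurd ⟨rfl, h'⟩ hc]
        · rintro ⟨h, h'⟩
          exact ⟨.inl h, h'⟩
      rw [this]
      exact i1 a
  rw [hs₁]
  obtain ⟨j1, j2, j3⟩ := hs₁'
  rw [← j2] at hx v1 v7
  rw [← j3 _ (by decide)] at b0 b1 b2 b12
  rw [← j3 15 (by decide)] at i2
  by_cases hc : x = m ∧ I.manPrefers m y w
  · obtain ⟨rfl, hp⟩ := hc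
    rw [Prog.run_ite_true (by simpa [Test.Holds, Expr.eval, hx, b0, b2, v1, v7, manPrefers] using hp)]
    refine ⟨fun a => by simpa using j1 a, fun b => ?_⟩
    simp only [Prog.run_put, Expr.eval, hx, b1, b12, State.setArr_self, Fin.val_inj]
    by_cases hby : b = y
    · subst hby
      simp [Records, hp]
    · simpa [hby, Ne.symm hby] using i2 b
  · rw [Prog.run_ite_false (by
      simpa [Test.Holds, Expr.eval, hx, b0, b2, v1, v7, Fin.val_inj, manPrefers]
        using fun h => by subst h; simpa [manPrefers] using hc)]
    refine ⟨fun a => by simpa using j1 a, fun b => ?_⟩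
    have : ((∃ l < k, f l = (m, b)) ∨ x = m ∧ y = b) ∧ I.manPrefers m b w ↔
        (∃ l < k, f l = (m, b)) ∧ I.manPrefers m b w := by
      constructor
      · rintro ⟨h | ⟨rfl, rfl⟩, h'⟩
        exacts [⟨h, h'⟩, absurd ⟨rfl, h'⟩ hc]
      · rintro ⟨h, h'⟩
        exact ⟨.inl h, h'⟩
    rw [this]
    exact i2 b

/-- Marks the edges of the reduced graph in array `6`. -/
def markProg : Prog :=
  .forLoop 6 5 (.ite
    (.and (.not (.eq (.get 0 (.var 6)) (.var 1))) (.and (.not (.eq (.get 1 (.var 6)) (.var 2)))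
      (.and
        (.not (.and (.lt (.const 0) (.get 14 (.get 0 (.var 6))))
          (.not (.lt (.succ (.get 2 (.var 6))) (.get 14 (.get 0 (.var 6)))))))
        (.not (.and (.lt (.const 0) (.get 15 (.get 1 (.var 6))))
          (.not (.lt (.succ (.get 12 (.var 6))) (.get 15 (.get 1 (.var 6))))))))))
    (.put 6 (.var 6) (.const 1)) .skip)

theorem runs_markProg (hl : I.Listing N f g) {s : State}
    (hs : I.HasEdges N f s) (h1 : s.var 1 = m) (h2 : s.var 2 = w)
    (h14 : ∀ a : Fin p, Records ((a, w) ∈ I.edges ∧ I.womanPrefers w a m) (I.menRank a w)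
      (s.arr 14 a))
    (h15 : ∀ b : Fin q, Records ((m, b) ∈ I.edges ∧ I.manPrefers m b w) (I.womenRank b m)
      (s.arr 15 b)) (h6 : ∀ x, s.arr 6 x = 0) {n : ℕ} (hn : N + 1 ≤ n) :
    Runs n markProg s fun s' => ∀ k < N, Records (f k ∈ I.reducedEdges m w) 0 (s'.arr 6 k) := by
  refine Runs.forLoop (fun i s' => (∀ k < i, Records (f k ∈ I.reducedEdges m w) 0 (s'.arr 6 k)) ∧
    ∀ k, i ≤ k → s'.arr 6 k = 0) hs.var5 hn (by simp [h6]) ?_ fun s' _ h => h.1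
  rintro k hk s' hf hx ⟨i1, i2⟩
  have hs' := hs.of_frame hf
  have v1 : s'.var 1 = m := by rw [hf.1 1 (by decide), h1]
  have v2 : s'.var 2 = w := by rw [hf.1 2 (by decide), h2]
  have h14 := h14 (f k).1
  have h15 := h15 (f k).2
  rw [← hf.2 14 (by decide)] at h14
  rw [← hf.2 15 (by decide)] at h15
  have t1 : (0 < s'.arr 14 (f k).1 ∧ s'.arr 14 (f k).1 ≤ I.menRank (f k).1 (f k).2 + 1) ↔
      ((f k).1, w) ∈ I.edges ∧ I.womanPrefers w (f k).1 m ∧ I.manPrefers (f k).1 w (f k).2 := by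
    rw [← and_assoc]
    rcases h14 with ⟨h, h'⟩ | ⟨h, h'⟩
    · simp [h, h', manPrefers]
    · simp [h, h']
  have t2 : (0 < s'.arr 15 (f k).2 ∧ s'.arr 15 (f k).2 ≤ I.womenRank (f k).2 (f k).1 + 1) ↔
      (m, (f k).2) ∈ I.edges ∧ I.manPrefers m (f k).2 w ∧ I.womanPrefers (f k).2 m (f k).1 := by
    rw [← and_assoc]
    rcases h15 with ⟨h, h'⟩ | ⟨h, h'⟩
    · simp [h, h', womanPrefers]
    · simp [h, h']
  have key : f k ∈ I.reducedEdges m w ↔ Test.Holds s' (.and (.not (.eq (.get 0 (.var 6)) (.var 1)))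
      (.and (.not (.eq (.get 1 (.var 6)) (.var 2)))
      (.and
        (.not (.and (.lt (.const 0) (.get 14 (.get 0 (.var 6))))
          (.not (.lt (.succ (.get 2 (.var 6))) (.get 14 (.get 0 (.var 6)))))))
        (.not (.and (.lt (.const 0) (.get 15 (.get 1 (.var 6))))
          (.not (.lt (.succ (.get 12 (.var 6))) (.get 15 (.get 1 (.var 6)))))))))) := by
    rw [mem_reducedEdges, ← t1, ← t2]
    simp only [hl.mem k hk, Test.Holds, Expr.eval, hx, hs'.arr0 k hk, hs'.arr1 k hk, hs'.arr2 k hk,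
      hs'.arr12 k hk, v1, v2, Fin.val_inj, not_lt, true_and, ne_eq]
  by_cases he : f k ∈ I.reducedEdges m w
  · rw [Prog.run_ite_true (key.1 he)]
    simp only [Prog.run_put, Expr.eval, State.setVar_arr, State.setArr_self, hx]
    refine ⟨fun l hl => ?_, fun l hl => ?_⟩
    · rcases Nat.lt_succ_iff_lt_or_eq.1 hl with hl | rfl
      · simpa [hl.ne] using i1 l hl
      · simp [Records, he]
    · rw [if_neg (by omega)]
      exact i2 l (by omega)
  · rw [Prog.run_ite_false (fun h => he (key.2 h))]
    simp only [Prog.run_skip, State.setVar_arr]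
    refine ⟨fun l hl => ?_, fun l hl => i2 l (by omega)⟩
    rcases Nat.lt_succ_iff_lt_or_eq.1 hl with hl | rfl
    · exact i1 l hl
    · exact .inr ⟨he, i2 _ le_rfl⟩

/-- The first phase. -/
def reduceProg : Prog :=
  .seq (.assign 5 (.var 0)) (.seq linkProg (.seq crossProg (.seq rankProg
    (.seq thresholdProg markProg))))

theorem runs_reduceProg (hl : I.Listing N f g) (hmw : (m, w) ∈ I.edges) {s : State}
    (hs : I.HasInput N f g s) (h0 : s.var 0 = N) (h1 : s.var 1 = m) (h2 : s.var 2 = w)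
    (hz : ∀ c, 6 ≤ c → ∀ x, s.arr c x = 0) {n : ℕ} (hn : 2 * N + 1 ≤ n) :
    Runs n reduceProg s fun s' => I.HasEdges N f s' ∧
      ∀ k < N, Records (f k ∈ I.reducedEdges m w) 0 (s'.arr 6 k) := by
  refine Runs.seq (Mid := fun s' => s'.var 5 = N) (.of_loopFree rfl (by omega)
    (by simp [Expr.eval, h0])) fun s₁ f₁ e₁ => ?_
  have i₁ : I.HasInput N f g s₁ := hs.of_arr_eq fun c _ => f₁.2 c (List.not_mem_nil)
  have z₁ : ∀ c, 6 ≤ c → ∀ x, s₁.arr c x = 0 := fun c hc x => by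
    rw [f₁.2 c List.not_mem_nil, hz c hc]
  refine Runs.seq (runs_linkProg i₁ e₁ (fun b => z₁ 11 (by decide) b) (by omega))
    fun s₂ f₂ ⟨e₂, e₂'⟩ => ?_
  have ne₂ : ∀ c, c ≠ 10 → c ≠ 11 → s₂.arr c = s₁.arr c := fun c h h' => f₂.2 c (by
    simp [linkProg, Prog.forLoop, Prog.arrs, h, h'])
  have i₂ : I.HasInput N f g s₂ := i₁.of_arr_eq fun c _ => ne₂ c (by omega) (by omega)
  have v₂ : s₂.var 5 = N := (f₂.1 5 (by decide)).trans e₁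
  refine Runs.seq (runs_crossProg hl i₂ v₂ e₂ e₂' hn) fun s₃ f₃ e₃ => ?_
  have i₃ : I.HasEdges N f s₃ := by
    refine ⟨(f₃.1 5 (by decide)).trans v₂, ?_, ?_, ?_, e₃⟩
    · rw [f₃.2 0 (by decide)]; exact i₂.arr0
    · rw [f₃.2 1 (by decide)]; exact i₂.arr1
    · rw [f₃.2 2 (by decide)]; exact i₂.arr2
  have v1₃ : s₃.var 1 = m := by
    rw [f₃.1 1 (by decide), f₂.1 1 (by decide), f₁.1 1 (by decide), h1]
  have v2₃ : s₃.var 2 = w := by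
    rw [f₃.1 2 (by decide), f₂.1 2 (by decide), f₁.1 2 (by decide), h2]
  refine Runs.seq (runs_rankProg hl hmw i₃ v1₃ v2₃ (by omega)) fun s₄ f₄ ⟨e₄, e₄'⟩ => ?_
  have i₄ := i₃.of_frame f₄
  have v1₄ : s₄.var 1 = m := by rw [f₄.1 1 (by decide), v1₃]
  have v2₄ : s₄.var 2 = w := by rw [f₄.1 2 (by decide), v2₃]
  refine Runs.seq (runs_thresholdProg hl i₄ v1₄ v2₄ e₄ e₄' (fun x => ?_) (fun x => ?_) (by omega))
    fun s₅ f₅ ⟨e₅, e₅'⟩ => ?_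
  · rw [f₄.2 14 (by decide), f₃.2 14 (by decide), f₂.2 14 (by decide), z₁ 14 (by decide)]
  · rw [f₄.2 15 (by decide), f₃.2 15 (by decide), f₂.2 15 (by decide), z₁ 15 (by decide)]
  have i₅ := i₄.of_frame f₅
  refine (runs_markProg hl i₅ (by rw [f₅.1 1 (by decide), v1₄]) (by rw [f₅.1 2 (by decide), v2₄])
    e₅ e₅' (fun x => ?_) (by omega)).mono fun s₆ f₆ e₆ => ⟨i₅.of_frame f₆, e₆⟩
  rw [f₅.2 6 (by decide), f₄.2 6 (by decide), f₃.2 6 (by decide), f₂.2 6 (by decide),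
    z₁ 6 (by decide)]

end Reduce

end TieInstance

namespace TieInstance

open RAM

/-! ## Second phase: the man-optimal super-stable matching -/

section Propose

variable {p q : ℕ} (I : TieInstance p q)

/-- The state of the woman `b` after the proposals `T`: `x` is one plus the rank of her best
proposal, `h` is one plus the man who made it, or `0` if two men did. -/
def WomanState (T : Finset (Fin p × Fin q)) (b : Fin q) (x h : ℕ) : Prop :=
  (x = 0 ∧ h = 0 ∧ ∀ a, (a, b) ∉ T) ∨
  ∃ a, (a, b) ∈ T ∧ x = I.womenRank b a + 1 ∧ (∀ a', (a', b) ∈ T → I.womanPrefers b a a') ∧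
    ((h = a + 1 ∧ ∀ a', (a', b) ∈ T → I.womenRank b a' = I.womenRank b a → a' = a) ∨
      h = 0 ∧ ∃ a' ≠ a, (a', b) ∈ T ∧ I.womenRank b a' = I.womenRank b a)

variable {I} {T F : Finset (Fin p × Fin q)} {a : Fin p} {b : Fin q} {x h : ℕ}

/-- A live proposal must be the unique best one of its woman; if two share the best rank, every
proposal to her is rejected. -/
theorem WomanState.mem_live_iff (hs : I.WomanState T b x h) :
    (a, b) ∈ I.live T ↔ h = a + 1 := by
  rw [mem_live]
  rcases hs with ⟨-, rfl, hT⟩ | ⟨c, hc, -, hmin, ⟨rfl, hu⟩ | ⟨rfl, c', hne, hc', he⟩⟩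
  · simp [hT]
  · constructor
    · rintro ⟨h1, h2⟩
      by_contra hcon
      exact h2 ⟨c, hc, fun h => hcon (by rw [h]), hmin a h1⟩
    · intro h
      obtain rfl : c = a := Fin.ext (by omega)
      refine ⟨hc, ?_⟩
      rintro ⟨d, hd, hne, hp⟩
      exact hne (hu d hd (le_antisymm hp (hmin d hd)))
  · refine iff_of_false ?_ (by omega)
    rintro ⟨h1, h2⟩
    by_cases hca : c = a
    · subst hca
      exact h2 ⟨c', hc', hne, he.le⟩
    · exact h2 ⟨c, hc, hca, hmin a h1⟩

theorem WomanState.lt (hs : I.WomanState T b x h) : h < p + 1 := by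
  rcases hs with ⟨-, rfl, -⟩ | ⟨c, -, -, -, ⟨rfl, -⟩ | ⟨rfl, -⟩⟩ <;> omega

theorem WomanState.eq_zero_iff (hs : I.WomanState T b x h) : x = 0 ↔ ∀ a, (a, b) ∉ T := by
  rcases hs with ⟨rfl, -, hT⟩ | ⟨c, hc, rfl, -⟩
  · simpa using hT
  · exact iff_of_false (by omega) fun h => h c hc

theorem WomanState.insert_of_ne {b' : Fin q} (hs : I.WomanState T b' x h) (hb : b' ≠ b) :
    I.WomanState (insert (a, b) T) b' x h := by
  simpa [WomanState, hb] using hs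

theorem WomanState.insert_of_lt (hs : I.WomanState T b x h) (hx : 0 < x)
    (hlt : x < I.womenRank b a + 1) : I.WomanState (insert (a, b) T) b x h := by
  rcases hs with ⟨rfl, -, -⟩ | ⟨c, hc, rfl, hmin, hh⟩
  · omega
  refine .inr ⟨c, Finset.mem_insert_of_mem hc, rfl, fun a' ha' => ?_, ?_⟩
  · rcases Finset.mem_insert.1 ha' with h | h
    · obtain rfl : a' = a := congrArg Prod.fst h
      simp only [womanPrefers]
      omega
    · exact hmin a' h
  · rcases hh with ⟨rfl, hu⟩ | ⟨rfl, a', hne, ha', he⟩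
    · refine .inl ⟨rfl, fun a' ha' he => ?_⟩
      rcases Finset.mem_insert.1 ha' with h | h
      · obtain rfl : a' = a := congrArg Prod.fst h
        omega
      · exact hu a' h he
    · exact .inr ⟨rfl, a', hne, Finset.mem_insert_of_mem ha', he⟩

theorem WomanState.insert_of_eq (hs : I.WomanState T b x h) (ha : (a, b) ∉ T)
    (heq : x = I.womenRank b a + 1) : I.WomanState (insert (a, b) T) b x 0 := by
  rcases hs with ⟨rfl, -, -⟩ | ⟨c, hc, rfl, hmin, -⟩
  · omega
  have he : I.womenRank b a = I.womenRank b c := by omega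
  refine .inr ⟨c, Finset.mem_insert_of_mem hc, rfl, fun a' ha' => ?_, .inr ⟨rfl, a, ?_,
    Finset.mem_insert_self _ _, he⟩⟩
  · rcases Finset.mem_insert.1 ha' with h | h
    · obtain rfl : a' = a := congrArg Prod.fst h
      exact he.symm.le
    · exact hmin a' h
  · rintro rfl
    exact ha hc

/-- This covers both a first proposal (`x = 0`) and a strict improvement. -/
theorem WomanState.insert_of_gt (hs : I.WomanState T b x h)
    (hlt : ¬ (0 < x ∧ x < I.womenRank b a + 1)) (hne : x ≠ I.womenRank b a + 1) :
    I.WomanState (insert (a, b) T) b (I.womenRank b a + 1) (a + 1) := by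
  have hT : ∀ a', (a', b) ∈ T → I.womenRank b a < I.womenRank b a' := by
    intro a' ha'
    rcases hs with ⟨-, -, hT⟩ | ⟨c, hc, rfl, hmin, -⟩
    · exact absurd ha' (hT a')
    · have := hmin a' ha'
      simp only [womanPrefers] at this
      omega
  refine .inr ⟨a, Finset.mem_insert_self _ _, rfl, fun a' ha' => ?_, .inl ⟨rfl, fun a' ha' he => ?_⟩⟩
  · rcases Finset.mem_insert.1 ha' with h | h
    · obtain rfl : a' = a := congrArg Prod.fst h
      exact le_rfl
    · exact (hT a' h).le
  · rcases Finset.mem_insert.1 ha' with h | h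
    · exact congrArg Prod.fst h
    · have := hT a' h
      omega

/-- This keeps the counters of live proposals exact when one woman changes her holder; it is stated
additively to avoid truncated subtraction. -/
theorem card_filter_update (H : ℕ → ℕ) (b : Fin q) (v c : ℕ) :
    (Finset.univ.filter fun b' : Fin q => Function.update H b v b' = c).card +
        (if H b = c then 1 else 0) =
      (Finset.univ.filter fun b' : Fin q => H b' = c).card + (if v = c then 1 else 0) := by
  simp only [Finset.card_filter]
  rw [← Finset.add_sum_erase _ _ (Finset.mem_univ b),
    ← Finset.add_sum_erase _ (fun b' : Fin q => if H b' = c then 1 else 0) (Finset.mem_univ b)]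
  have : ∑ x ∈ Finset.univ.erase b, (if Function.update H b v x = c then 1 else 0) =
      ∑ x ∈ Finset.univ.erase b, (if H x = c then 1 else 0) := by
    refine Finset.sum_congr rfl fun x hx => ?_
    rw [Function.update_of_ne]
    exact fun h => (Finset.mem_erase.1 hx).1 (Fin.ext h)
  rw [this, Function.update_self]
  omega

/-! ### Invariant of the proposal process -/

variable {N : ℕ} {f g : ℕ → Fin p × Fin q}

variable (I F N f) in
/-- The state of the algorithm after the proposals `T`.  The man `a` has scanned his list up to the
position `ptr a`; `cnt a` is the number of his live proposals and `cur a` the rank of his last one.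
The men who may have to go on are on the stack `st` of height `sp`. -/
structure ProposalInv (T : Finset (Fin p × Fin q)) (sp : ℕ)
    (ptr st cnt cur best holder : ℕ → ℕ) : Prop where
  mem_iff : ∀ k < N, f k ∈ T ↔ f k ∈ F ∧ k < ptr (f k).1
  sound : I.Sound F T
  ptr_eq : ∀ k < N, ∃ l < N, (f l).1 = (f k).1 ∧ (ptr (f k).1 = l ∨ ptr (f k).1 = l + 1)
  woman : ∀ b : Fin q, I.WomanState T b (best b) (holder b)
  cnt_eq : ∀ a : Fin p, cnt a = (Finset.univ.filter fun b : Fin q => holder b = a + 1).card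
  le_cur : ∀ a b, (a, b) ∈ T → I.menRank a b ≤ cur a
  cur_eq : ∀ a b, (a, b) ∈ T → ∃ b', (a, b') ∈ T ∧ I.menRank a b' = cur a
  stack : ∀ i < sp, ∃ k < N, st i = (f k).1
  done : ∀ k < N, (∃ i < sp, st i = (f k).1) ∨ (ptr (f k).1 < N → (f (ptr (f k).1)).1 = (f k).1 →
    0 < cnt (f k).1 ∧ I.menRank (f k).1 (f (ptr (f k).1)).2 ≠ cur (f k).1)

namespace ProposalInv

variable {sp : ℕ} {ptr st cnt cur best holder : ℕ → ℕ}

theorem exists_live (hi : I.ProposalInv F N f T sp ptr st cnt cur best holder) {a : Fin p}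
    (h : 0 < cnt a) : ∃ b, (a, b) ∈ I.live T := by
  rw [hi.cnt_eq, Finset.card_pos] at h
  obtain ⟨b, hb⟩ := h
  exact ⟨b, (hi.woman b).mem_live_iff.2 (Finset.mem_filter.1 hb).2⟩

theorem cnt_pos (hi : I.ProposalInv F N f T sp ptr st cnt cur best holder) {a : Fin p} {b : Fin q}
    (h : (a, b) ∈ I.live T) : 0 < cnt a := by
  rw [hi.cnt_eq, Finset.card_pos]
  exact ⟨b, Finset.mem_filter.2 ⟨Finset.mem_univ _, (hi.woman b).mem_live_iff.1 h⟩⟩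

theorem pop (hi : I.ProposalInv F N f T (sp + 1) ptr st cnt cur best holder) {a : Fin p}
    (ha : st sp = a) (hq : ptr a < N → (f (ptr a)).1 = a →
      0 < cnt a ∧ I.menRank a (f (ptr a)).2 ≠ cur a) :
    I.ProposalInv F N f T sp ptr st cnt cur best holder := by
  refine { hi with stack := fun i h => hi.stack i (by omega), done := fun k hk => ?_ }
  rcases hi.done k hk with ⟨i, h, he⟩ | h
  · rcases Nat.lt_succ_iff_lt_or_eq.1 h with h | rfl
    · exact .inl ⟨i, h, he⟩
    · rw [ha] at he
      rw [← Fin.ext he]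
      exact .inr hq
  · exact .inr h

/-- `a` has scanned one more position. -/
theorem ptr_update_eq {a : Fin p} {k l : ℕ} (hfk : (f k).1 = a) (hptr : ptr a = k) :
    l < Function.update ptr a (k + 1) (f l).1 ↔ l = k ∨ l < ptr (f l).1 := by
  by_cases h : (f l).1 = a
  · rw [h, Function.update_self, hptr]
    omega
  · rw [Function.update_of_ne (fun h' => h (Fin.ext h'))]
    refine ⟨.inr, ?_⟩
    rintro (rfl | h')
    exacts [absurd hfk h, h']

theorem update_ptr_eq (hi : I.ProposalInv F N f T sp ptr st cnt cur best holder)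
    {a : Fin p} {k : ℕ} (hk : k < N) (hfk : (f k).1 = a) (l : ℕ) (hl : l < N) :
    ∃ i < N, (f i).1 = (f l).1 ∧ (Function.update ptr a (k + 1) (f l).1 = i ∨
      Function.update ptr a (k + 1) (f l).1 = i + 1) := by
  by_cases h : (f l).1 = a
  · exact ⟨k, hk, hfk.trans h.symm, .inr (by rw [h, Function.update_self])⟩
  · rw [Function.update_of_ne (fun h' => h (Fin.ext h'))]
    exact hi.ptr_eq l hl

theorem skip (hi : I.ProposalInv F N f T (sp + 1) ptr st cnt cur best holder)
    {a : Fin p} {k : ℕ}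
    (ha : st sp = a) (hptr : ptr a = k) (hk : k < N) (hfk : (f k).1 = a) (hF : f k ∉ F) :
    I.ProposalInv F N f T (sp + 1) (Function.update ptr a (k + 1)) st cnt cur best holder := by
  refine { hi with
    mem_iff := fun l hlN => ?_, ptr_eq := hi.update_ptr_eq hk hfk, done := fun l hlN => ?_ }
  · rw [hi.mem_iff l hlN, ptr_update_eq hfk hptr]
    refine and_congr_right fun h => ⟨.inr, ?_⟩
    rintro (rfl | h')
    exacts [absurd h hF, h']
  · by_cases h : (f l).1 = a
    · exact .inl ⟨sp, by omega, by rw [ha, h]⟩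
    · rw [Function.update_of_ne (fun h' => h (Fin.ext h'))]
      exact hi.done l hlN

/-- The proposal at position `k` is sound if the man has no live proposals, or if his last one was
in the same tie. -/
theorem sound_insert (hi : I.ProposalInv F N f T sp ptr st cnt cur best holder)
    (hl : I.Listing N f g) (hFE : F ⊆ I.edges) {a : Fin p} {b : Fin q} {k : ℕ} (hptr : ptr a = k)
    (hfk : f k = (a, b)) (hF : f k ∈ F)
    (hact : ¬ (0 < cnt a ∧ I.menRank a b ≠ cur a)) : I.Sound F (insert (a, b) T) := by
  by_cases hc : 0 < cnt a
  · obtain ⟨b₁, hb₁⟩ := hi.exists_live hc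
    obtain ⟨b₂, hb₂, he⟩ := hi.cur_eq a b₁ (live_subset hb₁)
    refine hi.sound.insert_of_tie (hfk ▸ hF) hb₂ (he.trans ?_)
    by_contra hne
    exact hact ⟨hc, fun h => hne h.symm⟩
  -- The man has no live proposal. The edges of `F` that he strictly prefers come earlier in his
  -- list, so they were proposed and, not being live, rejected.
  · refine hi.sound.insert_of_rejected (hfk ▸ hF) fun b' hb' hp => ?_
    obtain ⟨l, hlN, he⟩ := hl.exists_eq _ (hFE hb')
    have hlk : l < k := by
      by_contra hcon
      have := hl.rank_le k l (by omega) hlN (by rw [hfk, he])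
      rw [hfk, he] at this
      exact hp this
    have hT : (a, b') ∈ T := by
      rw [← he, hi.mem_iff l hlN, he]
      exact ⟨hb', by simpa [hptr] using hlk⟩
    by_contra hcon
    exact hc (hi.cnt_pos (mem_live.2 ⟨hT, hcon⟩))

/-- One statement for all three reactions of the woman (reject, tie, accept): `x` and `v` are her
new cells, and the hypotheses on `cnt'`, `st'`, `sp'` say that a displaced holder loses one live
proposal and lands on the stack. -/
theorem propose (hi : I.ProposalInv F N f T (sp + 1) ptr st cnt cur best holder)
    (hl : I.Listing N f g) (hFE : F ⊆ I.edges) {a : Fin p} {b : Fin q} {k : ℕ}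
    (ha : st sp = a) (hptr : ptr a = k) (hk : k < N) (hfk : f k = (a, b)) (hF : f k ∈ F)
    (hact : ¬ (0 < cnt a ∧ I.menRank a b ≠ cur a)) {x v sp' : ℕ} {st' cnt' : ℕ → ℕ}
    (hW : I.WomanState (insert (a, b) T) b x v)
    (hcnt : ∀ c : Fin p, cnt' c + (if holder b = c + 1 then 1 else 0) =
      cnt c + (if v = c + 1 then 1 else 0))
    (hst : ∀ i < sp + 1, st' i = st i) (hsp : sp + 1 ≤ sp')
    (hst' : ∀ i, sp + 1 ≤ i → i < sp' → holder b = st' i + 1)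
    (hdis : ∀ c, holder b = c + 1 → v ≠ c + 1 → ∃ i < sp', st' i = c) :
    I.ProposalInv F N f (insert (a, b) T) sp' (Function.update ptr a (k + 1)) st' cnt'
      (Function.update cur a (I.menRank a b)) (Function.update best b x)
      (Function.update holder b v) := by
  have hfk1 : (f k).1 = a := by rw [hfk]
  have hcur : ∀ b', (a, b') ∈ T → I.menRank a b' ≤ I.menRank a b := by
    intro b' hb'
    obtain ⟨l, hlN, he⟩ := hl.exists_eq _ (hFE (hi.sound.1 hb'))
    have h1 := ((hi.mem_iff l hlN).1 (he ▸ hb')).2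
    rw [he] at h1
    have := hl.rank_le l k (by simp only [hptr] at h1; omega) hk (by rw [hfk, he])
    rwa [hfk, he] at this
  constructor
  · intro l hlN
    rw [ptr_update_eq hfk1 hptr, Finset.mem_insert, hi.mem_iff l hlN, ← hfk]
    constructor
    · rintro (h | ⟨h1, h2⟩)
      · obtain rfl := hl.inj l hlN k hk h
        exact ⟨hF, .inl rfl⟩
      · exact ⟨h1, .inr h2⟩
    · rintro ⟨h1, rfl | h2⟩
      exacts [.inl rfl, .inr ⟨h1, h2⟩]
  · exact hi.sound_insert hl hFE hptr hfk hF hact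
  · exact hi.update_ptr_eq hk hfk1
  · intro b'
    by_cases h : b' = b
    · subst h
      simpa using hW
    · rw [Function.update_of_ne (fun h' => h (Fin.ext h')),
        Function.update_of_ne (fun h' => h (Fin.ext h'))]
      exact (hi.woman b').insert_of_ne h
  · intro c
    have h1 := hcnt c
    have h2 := card_filter_update holder b v (c + 1)
    rw [hi.cnt_eq c] at h1
    omega
  · intro c d hcd
    by_cases h : c = a
    · subst h
      rw [Function.update_self]
      rcases Finset.mem_insert.1 hcd with h | h
      · rw [(Prod.mk.inj h).2]
      · exact hcur d h
    · rw [Function.update_of_ne (fun h' => h (Fin.ext h'))]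
      rcases Finset.mem_insert.1 hcd with h' | h'
      · exact absurd (Prod.mk.inj h').1 h
      · exact hi.le_cur c d h'
  · intro c d hcd
    by_cases h : c = a
    · subst h
      exact ⟨b, Finset.mem_insert_self _ _, by rw [Function.update_self]⟩
    · rw [Function.update_of_ne (fun h' => h (Fin.ext h'))]
      rcases Finset.mem_insert.1 hcd with h' | h'
      · exact absurd (Prod.mk.inj h').1 h
      · obtain ⟨d', hd', he⟩ := hi.cur_eq c d h'
        exact ⟨d', Finset.mem_insert_of_mem hd', he⟩
  · intro i hisp
    by_cases h : i < sp + 1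
    · rw [hst i h]
      exact hi.stack i h
    · have h1 := hst' i (by omega) hisp
      have h2 := (hi.woman b).lt
      have h3 : (⟨st' i, by omega⟩, b) ∈ I.live T := (hi.woman b).mem_live_iff.2 h1
      obtain ⟨l, hlN, he⟩ := hl.exists_eq _ (hFE (hi.sound.1 (live_subset h3)))
      exact ⟨l, hlN, by rw [he]⟩
  · intro l hlN
    by_cases h : (f l).1 = a
    · exact .inl ⟨sp, by omega, by rw [hst _ (by omega), ha, h]⟩
    · have h' : ((f l).1 : ℕ) ≠ a := fun h' => h (Fin.ext h')
      simp only [Function.update_of_ne h']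
      by_cases hd : holder b = (f l).1 + 1 ∧ v ≠ (f l).1 + 1
      · exact .inl (hdis _ hd.1 hd.2)
      · rcases hi.done l hlN with ⟨i, h1, h2⟩ | h1
        · exact .inl ⟨i, by omega, by rw [hst i h1, h2]⟩
        · refine .inr fun h2 h3 => ?_
          obtain ⟨h4, h5⟩ := h1 h2 h3
          refine ⟨?_, h5⟩
          -- The counter of a man drops only when he is the displaced holder, which is excluded
          -- here; so he stays at rest.
          have h6 := hcnt (f l).1
          split_ifs at h6 <;> omega

/-- With an empty stack, a man who has not reached `b` is at rest: he has a live proposal and his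
next entry lies in a later tie. That live proposal is strictly better than `b` and not rejected,
against the assumption on `b`. -/
theorem closed (hi : I.ProposalInv F N f T 0 ptr st cnt cur best holder)
    (hl : I.Listing N f g) (hFE : F ⊆ I.edges) : I.Closed F T := by
  intro a b hF hbet
  obtain ⟨l, hlN, he⟩ := hl.exists_eq _ (hFE hF)
  by_contra hcon
  have hle : ptr a ≤ l := by
    by_contra h
    refine hcon ?_
    rw [← he, hi.mem_iff l hlN, he]
    exact ⟨hF, by simpa using h⟩
  -- The pointer is a position of `a`, or directly follows one while not exceeding the position `l`
  -- of `a`; since lists are contiguous, it points into the list of `a`.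
  have hpl : ptr a < N ∧ (f (ptr a)).1 = a := by
    refine ⟨by omega, ?_⟩
    obtain ⟨i, hiN, h1, h2⟩ := hi.ptr_eq l hlN
    rw [he] at h1 h2
    rcases h2 with h2 | h2 <;> simp only at h1 h2
    · rw [h2, h1]
    · refine le_antisymm ?_ ?_
      · have := hl.man_le (ptr a) l hle hlN
        rwa [he] at this
      · have := hl.man_le i (ptr a) (by omega) (by omega)
        rwa [h1] at this
  rcases hi.done l hlN with ⟨i, h1, -⟩ | h
  · omega
  rw [he] at h
  obtain ⟨h1, h2⟩ := h hpl.1 hpl.2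
  obtain ⟨b₁, hb₁⟩ := hi.exists_live h1
  obtain ⟨b₂, hb₂, hc⟩ := hi.cur_eq a b₁ (live_subset hb₁)
  obtain ⟨i, hiN, hie⟩ := hl.exists_eq _ (hFE (hi.sound.1 hb₂))
  have h3 := ((hi.mem_iff i hiN).1 (hie ▸ hb₂)).2
  rw [hie] at h3
  have h4 := hl.rank_le i (ptr a) (by simp only at h3; omega) hpl.1 (by rw [hie, hpl.2])
  have h5 := hl.rank_le (ptr a) l hle hlN (by rw [he, hpl.2])
  have h6 := hi.le_cur a b₁ (live_subset hb₁)
  rw [hie] at h4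
  rw [he, hpl.2] at h5
  simp only at h2 h4 h5
  refine (mem_live.1 hb₁).2 (hbet b₁ (hi.sound.1 (live_subset hb₁)) ?_)
  simp only [manPrefers]
  omega

end ProposalInv

end Propose

end TieInstance

namespace TieInstance

open RAM

/-! ### The proposal programs and their running time -/

section Propose

variable {p q N : ℕ} {I : TieInstance p q} {f g : ℕ → Fin p × Fin q} {F T : Finset (Fin p × Fin q)}

/-- Initializes the pointers `16` into the men's lists and the stack `17`. -/
def initProg : Prog :=
  .forLoop 6 5 (.seq (.put 17 (.var 6) (.get 0 (.var 6)))
    (.ite (.and (.lt (.const 0) (.var 6)) (.eq (.get 0 (.pred (.var 6))) (.get 0 (.var 6)))) .skip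
      (.put 16 (.get 0 (.var 6)) (.var 6))))

/-- The stack receives the man of every position. Repetitions are harmless, and no list of men with
positive degree is needed. -/
theorem runs_initProg (hl : I.Listing N f g) {s : State} (hs : I.HasEdges N f s) {n : ℕ}
    (hn : N + 1 ≤ n) :
    Runs n initProg s fun s' => (∀ k < N, s'.arr 17 k = (f k).1) ∧
      ∀ k < N, s'.arr 16 (f k).1 ≤ k ∧ (f (s'.arr 16 (f k).1)).1 = (f k).1 := by
  refine Runs.forLoop (fun i s' => (∀ k < i, s'.arr 17 k = (f k).1) ∧
      ∀ k < i, s'.arr 16 (f k).1 ≤ k ∧ (f (s'.arr 16 (f k).1)).1 = (f k).1) hs.var5 hn (by simp) ?_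
    fun s' _ h => h
  rintro k hk s' hf hx ⟨i1, i2⟩
  have hs' := hs.of_frame hf
  simp only [Prog.run_seq, Prog.run_put, Expr.eval, hx, hs'.arr0 k hk]
  by_cases hc : 0 < k ∧ (f (k - 1)).1 = (f k).1
  · rw [Prog.run_ite_true (by
      simpa [Test.Holds, Expr.eval, hx, hs'.arr0 k hk, hs'.arr0 (k - 1) (by omega), Fin.val_inj]
        using hc)]
    refine ⟨fun l hlk => ?_, fun l hlk => ?_⟩
    · simp only [Prog.run_skip, State.setVar_arr, State.setArr_self]
      split_ifs with h
      · rw [h]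
      · exact i1 l (by omega)
    · simp only [Prog.run_skip, State.setVar_arr, State.setArr_ne, ne_eq, Nat.reduceEqDiff,
        not_false_eq_true]
      rcases Nat.lt_succ_iff_lt_or_eq.1 hlk with h | rfl
      · exact i2 l h
      · rw [← hc.2]
        obtain ⟨h1, h2⟩ := i2 (l - 1) (by omega)
        exact ⟨by omega, h2⟩
  · rw [Prog.run_ite_false (by
      by_cases h0 : 0 < k
      · simpa [Test.Holds, Expr.eval, hx, hs'.arr0 k hk, hs'.arr0 (k - 1) (by omega), Fin.val_inj]
          using hc
      · simp [Test.Holds, Expr.eval, hx, h0])]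
    refine ⟨fun l hlk => ?_, fun l hlk => ?_⟩
    · simp only [Prog.run_put, Expr.eval, State.setVar_arr, State.setArr_self, State.setArr_ne,
        State.setArr_var, ne_eq, Nat.reduceEqDiff, not_false_eq_true]
      split_ifs with h
      · rw [h]
      · exact i1 l (by omega)
    · simp only [Prog.run_put, Expr.eval, State.setVar_arr, State.setArr_self, State.setArr_ne,
        State.setArr_var, ne_eq, Nat.reduceEqDiff, not_false_eq_true, hx, hs'.arr0 k hk,
        Fin.val_inj]
      split_ifs with h
      · refine ⟨?_, h.symm⟩
        by_contra hlt
        refine hc ⟨by omega, le_antisymm (hl.man_le _ _ (by omega) hk) ?_⟩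
        rw [← h]
        exact hl.man_le _ _ (by omega) (by omega)
      · rcases Nat.lt_succ_iff_lt_or_eq.1 hlk with h' | rfl
        · exact i2 l h'
        · exact absurd rfl h

/-- The displaced man in register `13` (if any) loses a live proposal and goes to the stack. -/
def displaceProg : Prog :=
  .ite (.lt (.const 0) (.var 13))
    (.seq (.put 18 (.pred (.var 13)) (.pred (.get 18 (.pred (.var 13)))))
      (.seq (.put 17 (.var 9) (.pred (.var 13))) (.assign 9 (.succ (.var 9))))) .skip

/-- The man in register `10` proposes to the woman in register `12`, at position `11`. -/
def proposeProg : Prog :=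
  .seq (.assign 12 (.get 1 (.var 11))) (.seq (.put 19 (.var 10) (.get 2 (.var 11)))
    (.ite (.and (.lt (.const 0) (.get 20 (.var 12)))
        (.lt (.get 20 (.var 12)) (.succ (.get 12 (.var 11))))) .skip
      (.seq (.assign 13 (.get 21 (.var 12))) (.seq displaceProg
        (.ite (.eq (.get 20 (.var 12)) (.succ (.get 12 (.var 11)))) (.put 21 (.var 12) (.const 0))
          (.seq (.put 20 (.var 12) (.succ (.get 12 (.var 11))))
            (.seq (.put 21 (.var 12) (.succ (.var 10)))
              (.put 18 (.var 10) (.succ (.get 18 (.var 10)))))))))))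

/-- One step of the algorithm, for the man on top of the stack. -/
def stepProg : Prog :=
  .seq (.assign 10 (.get 17 (.pred (.var 9)))) (.seq (.assign 11 (.get 16 (.var 10)))
    (.ite (.and (.lt (.var 11) (.var 5)) (.and (.eq (.get 0 (.var 11)) (.var 10))
        (.not (.and (.lt (.const 0) (.get 18 (.var 10)))
          (.not (.eq (.get 2 (.var 11)) (.get 19 (.var 10))))))))
      (.seq (.put 16 (.var 10) (.succ (.var 11)))
        (.ite (.eq (.get 6 (.var 11)) (.const 1)) proposeProg .skip))
      (.assign 9 (.pred (.var 9)))))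

variable (I F N f) in
/-- The memory is in the state described by `ProposalInv`. -/
def StateInv (T : Finset (Fin p × Fin q)) (s : State) : Prop :=
  I.ProposalInv F N f T (s.var 9) (s.arr 16) (s.arr 17) (s.arr 18) (s.arr 19) (s.arr 20) (s.arr 21)

theorem run_displaceProg {s : State} {cnt : ℕ} (hc : s.var 13 = 0 ∨ s.arr 18 (s.var 13 - 1) = cnt + 1) :
    (Prog.run displaceProg s).arr 18 =
        (if 0 < s.var 13 then Function.update (s.arr 18) (s.var 13 - 1) cnt else s.arr 18) ∧
      (Prog.run displaceProg s).arr 17 =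
        (if 0 < s.var 13 then Function.update (s.arr 17) (s.var 9) (s.var 13 - 1) else s.arr 17) ∧
      (Prog.run displaceProg s).var 9 = (if 0 < s.var 13 then s.var 9 + 1 else s.var 9) := by
  by_cases h : 0 < s.var 13
  · have h' : s.arr 18 (s.var 13 - 1) = cnt + 1 := by omega
    rw [displaceProg, Prog.run_ite_true (by simpa [Test.Holds, Expr.eval] using h)]
    simp [Expr.eval, State.setArr_arr_self, State.setArr_arr_ne, h, h']
  · rw [displaceProg, Prog.run_ite_false (by simpa [Test.Holds, Expr.eval] using h)]
    simp [h]

theorem run_proposeProg (hl : I.Listing N f g) (hFE : F ⊆ I.edges) {s : State}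
    (hs : I.HasEdges N f s) {sp k : ℕ} {a : Fin p} {b : Fin q} {ptr : ℕ → ℕ}
    (hi : I.ProposalInv F N f T (sp + 1) ptr (s.arr 17) (s.arr 18) (s.arr 19) (s.arr 20) (s.arr 21))
    (h9 : s.var 9 = sp + 1) (h10 : s.var 10 = a) (h11 : s.var 11 = k) (hst : s.arr 17 sp = a)
    (hptr : ptr a = k) (h16 : s.arr 16 = Function.update ptr a (k + 1)) (hk : k < N)
    (hfk : f k = (a, b)) (hF : f k ∈ F)
    (hact : ¬ (0 < s.arr 18 a ∧ I.menRank a b ≠ s.arr 19 a)) :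
    I.StateInv N f F (insert (a, b) T) (Prog.run proposeProg s) ∧
      (Prog.run proposeProg s).var 9 ≤ sp + 2 := by
  have b1 := hs.arr1 k hk
  have b2 := hs.arr2 k hk
  have b12 := hs.arr12 k hk
  rw [hfk] at b1 b2 b12
  simp only at b1 b2 b12
  have hW := hi.woman b
  have hT : (a, b) ∉ T := by
    rw [← hfk, hi.mem_iff k hk, hfk]
    simp [hptr]
  have hha : s.arr 21 b ≠ a + 1 := fun h => hT (live_subset (hW.mem_live_iff.2 h))
  have hP := @ProposalInv.propose p q I T F N f g sp ptr _ _ _ _ _ hi hl hFE a b k hst hptr hk hfk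
    hF hact
  rw [proposeProg]
  simp only [Prog.run_seq, Prog.run_assign, Prog.run_put, Expr.eval, h11, h10, b1, b2,
    State.setVar_arr, State.setVar_ne, ne_eq, Nat.reduceEqDiff, not_false_eq_true]
  obtain ⟨s₁, hs₁⟩ : ∃ s₁, (s.setVar 12 b).setArr 19 a (I.menRank a b) = s₁ := ⟨_, rfl⟩
  have c19 : s₁.arr 19 = Function.update (s.arr 19) a (I.menRank a b) := by
    rw [← hs₁, State.setArr_arr_self, State.setVar_arr]
  have cne : ∀ c ≠ 19, s₁.arr c = s.arr c := fun c hc => by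
    rw [← hs₁, State.setArr_arr_ne _ _ _ hc, State.setVar_arr]
  have c12 : s₁.var 12 = b := by simp [← hs₁]
  have cv : ∀ c ≠ 12, s₁.var c = s.var c := fun c hc => by simp [← hs₁, hc]
  rw [hs₁]
  have t9 := (cv 9 (by decide)).trans h9
  have t10 := (cv 10 (by decide)).trans h10
  have t11 := (cv 11 (by decide)).trans h11
  by_cases hlt : 0 < s.arr 20 b ∧ s.arr 20 b < I.womenRank b a + 1
  · rw [Prog.run_ite_true (by
      simpa [Test.Holds, Expr.eval, c12, t11, cne 20 (by decide), cne 12 (by decide), b12] using hlt)]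
    rw [Prog.run_skip, StateInv, t9, c19, cne 16 (by decide), cne 17 (by decide), cne 18 (by decide),
      cne 20 (by decide), cne 21 (by decide), h16]
    have := hP (hW.insert_of_lt hlt.1 hlt.2) (cnt' := s.arr 18) (st' := s.arr 17) (sp' := sp + 1)
      (fun _ => rfl) (fun _ _ => rfl) le_rfl (fun i _ _ => by omega) (fun c h1 h2 => absurd h1 h2)
    rw [Function.update_eq_self, Function.update_eq_self] at this
    exact ⟨this, by omega⟩
  rw [Prog.run_ite_false (by
    simpa [Test.Holds, Expr.eval, c12, t11, cne 20 (by decide), cne 12 (by decide), b12] using hlt)]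
  simp only [Prog.run_seq, Prog.run_assign, Expr.eval, c12, cne 21 (by decide)]
  -- A displaced holder has a live proposal, so his counter is positive and the truncated
  -- predecessor taken by the program is exact.
  obtain ⟨cnt, hcnt⟩ : ∃ cnt, s.arr 21 b = 0 ∨ s.arr 18 (s.arr 21 b - 1) = cnt + 1 := by
    by_cases h0 : s.arr 21 b = 0
    · exact ⟨0, .inl h0⟩
    · have hlt := hW.lt
      have h1 := hi.cnt_pos (hW.mem_live_iff.2
        (show s.arr 21 b = ((⟨s.arr 21 b - 1, by omega⟩ : Fin p) : ℕ) + 1 by simp only; omega))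
      exact ⟨s.arr 18 (s.arr 21 b - 1) - 1, .inr (by simp only at h1; omega)⟩
  obtain ⟨r18, r17, r9⟩ := run_displaceProg (s := s₁.setVar 13 (s.arr 21 b)) (cnt := cnt)
    (by simpa [cne 18 (by decide)] using hcnt)
  have rf : Frame displaceProg (s₁.setVar 13 (s.arr 21 b))
      (Prog.run displaceProg (s₁.setVar 13 (s.arr 21 b))) :=
    (Prog.exec_run rfl _).choose_spec.2.frame
  simp only [State.setVar_self, State.setVar_arr, State.setVar_ne, ne_eq, Nat.reduceEqDiff,
    not_false_eq_true, cne 18 (by decide), cne 17 (by decide), t9] at r18 r17 r9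
  generalize Prog.run displaceProg (s₁.setVar 13 (s.arr 21 b)) = s₂ at r18 r17 r9 rf ⊢
  have d16 : s₂.arr 16 = Function.update ptr a (k + 1) := by
    rw [rf.2 16 (by decide), State.setVar_arr, cne 16 (by decide), h16]
  have d19 : s₂.arr 19 = Function.update (s.arr 19) a (I.menRank a b) := by
    rw [rf.2 19 (by decide), State.setVar_arr, c19]
  have d20 : s₂.arr 20 = s.arr 20 := by
    rw [rf.2 20 (by decide), State.setVar_arr, cne 20 (by decide)]
  have d21 : s₂.arr 21 = s.arr 21 := by
    rw [rf.2 21 (by decide), State.setVar_arr, cne 21 (by decide)]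
  have d12 : s₂.arr 12 = s.arr 12 := by
    rw [rf.2 12 (by decide), State.setVar_arr, cne 12 (by decide)]
  have u12 : s₂.var 12 = b := by rw [rf.1 12 (by decide), State.setVar_ne _ _ (by decide), c12]
  have u11 : s₂.var 11 = k := by rw [rf.1 11 (by decide), State.setVar_ne _ _ (by decide), t11]
  have u10 : s₂.var 10 = a := by rw [rf.1 10 (by decide), State.setVar_ne _ _ (by decide), t10]
  have e18 : ∀ c : ℕ, s₂.arr 18 c + (if s.arr 21 b = c + 1 then 1 else 0) = s.arr 18 c := by
    intro c
    rw [r18]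
    by_cases h0 : 0 < s.arr 21 b
    · rw [if_pos h0, Function.update_apply]
      by_cases hc : c = s.arr 21 b - 1
      · rw [if_pos hc, if_pos (by omega), hc]
        omega
      · rw [if_neg hc, if_neg (by omega)]
        omega
    · rw [if_neg h0, if_neg (by omega)]
      omega
  have e17 : ∀ i < sp + 1, s₂.arr 17 i = s.arr 17 i := by
    intro i h
    rw [r17]
    split_ifs
    · rw [Function.update_of_ne (by omega)]
    · rfl
  have e9 : sp + 1 ≤ s₂.var 9 := by rw [r9]; split_ifs <;> omega
  have e9' : s₂.var 9 ≤ sp + 2 := by rw [r9]; split_ifs <;> omega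
  have e17' : ∀ i, sp + 1 ≤ i → i < s₂.var 9 → s.arr 21 b = s₂.arr 17 i + 1 := by
    intro i h1 h2
    rw [r17]
    rw [r9] at h2
    split_ifs at h2 ⊢ with h0
    · obtain rfl : i = sp + 1 := by omega
      rw [Function.update_self]
      omega
    · omega
  have edis : ∀ c, s.arr 21 b = c + 1 → ∃ i < s₂.var 9, s₂.arr 17 i = c := by
    intro c hc
    refine ⟨sp + 1, ?_, ?_⟩
    · rw [r9, if_pos (by omega)]; omega
    · rw [r17, if_pos (by omega), Function.update_self]; omega
  by_cases heq : s.arr 20 b = I.womenRank b a + 1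
  · rw [Prog.run_ite_true (by
      simpa [Test.Holds, Expr.eval, u12, u11, d20, d12, b12] using heq)]
    have := hP (hW.insert_of_eq hT heq) (cnt' := s₂.arr 18) (st' := s₂.arr 17) (sp' := s₂.var 9)
      (fun c => by simpa using e18 c) e17 e9 e17' (fun c h1 _ => edis c h1)
    rw [Function.update_eq_self] at this
    simp only [Prog.run_put, Expr.eval, u12, StateInv, State.setArr_arr_self, State.setArr_arr_ne,
      State.setArr_var, ne_eq, Nat.reduceEqDiff, not_false_eq_true, d16, d19, d20, d21]
    exact ⟨this, e9'⟩
  · rw [Prog.run_ite_false (by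
      simpa [Test.Holds, Expr.eval, u12, u11, d20, d12, b12] using heq)]
    have := hP (hW.insert_of_gt hlt heq) (cnt' := Function.update (s₂.arr 18) a (s₂.arr 18 a + 1))
      (st' := s₂.arr 17) (sp' := s₂.var 9)
      (fun c => by
        have h1 := e18 c
        by_cases hc : a = c
        · subst hc
          rw [if_neg hha] at h1 ⊢
          simp only [Function.update_self, if_true]
          omega
        · have hc' : (a : ℕ) ≠ c := fun h => hc (Fin.ext h)
          rw [Function.update_of_ne (Ne.symm hc'), if_neg (show ¬ (a : ℕ) + 1 = c + 1 by omega)]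
          omega)
      e17 e9 e17' (fun c h1 _ => edis c h1)
    simp only [Prog.run_seq, Prog.run_put, Expr.eval, u12, u11, u10, StateInv,
      State.setArr_arr_self, State.setArr_arr_ne, State.setArr_var, ne_eq, Nat.reduceEqDiff,
      not_false_eq_true, d16, d19, d20, d21, d12, b12]
    exact ⟨this, e9'⟩

variable (N f) in
/-- The potential of the main loop. -/
def potential (s : State) : ℕ :=
  -- The weight `2` pays for scanning a position: this may push one displaced man, and the sum must
  -- still decrease. The other steps pop the stack.
  2 * ((Finset.range N).filter fun k => s.arr 16 (f k).1 ≤ k).card + s.var 9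

theorem potential_update {ptr : ℕ → ℕ} {a : Fin p} {k : ℕ} (hk : k < N) (hfk : (f k).1 = a)
    (hptr : ptr a = k) :
    ((Finset.range N).filter fun l => Function.update ptr a (k + 1) (f l).1 ≤ l).card <
      ((Finset.range N).filter fun l => ptr (f l).1 ≤ l).card := by
  refine Finset.card_lt_card ?_
  rw [Finset.ssubset_iff_of_subset]
  · exact ⟨k, by simp [hk, hfk, hptr], by simp [hfk]⟩
  · intro l hl
    simp only [Finset.mem_filter, Finset.mem_range] at hl ⊢
    refine ⟨hl.1, ?_⟩
    by_contra hcon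
    have := (ProposalInv.ptr_update_eq hfk hptr).2 (.inr (Nat.lt_of_not_le hcon))
    omega

theorem run_stepProg (hl : I.Listing N f g) (hFE : F ⊆ I.edges) {s : State}
    (hs : I.HasEdges N f s) (h6 : ∀ k < N, Records (f k ∈ F) 0 (s.arr 6 k))
    (h9 : 0 < s.var 9) (hi : I.StateInv N f F T s) :
    (∃ T, I.StateInv N f F T (Prog.run stepProg s)) ∧
      potential N f (Prog.run stepProg s) < potential N f s := by
  obtain ⟨sp, hsp⟩ : ∃ sp, s.var 9 = sp + 1 := ⟨s.var 9 - 1, by omega⟩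
  rw [StateInv, hsp] at hi
  obtain ⟨k₀, hk₀, hst⟩ := hi.stack sp (by omega)
  obtain ⟨a, ha⟩ : ∃ a, (f k₀).1 = a := ⟨_, rfl⟩
  rw [ha] at hst
  obtain ⟨k, hk⟩ : ∃ k, s.arr 16 a = k := ⟨_, rfl⟩
  rw [stepProg]
  simp only [Prog.run_seq, Prog.run_assign, Expr.eval, hsp, Nat.add_sub_cancel, hst,
    State.setVar_arr, State.setVar_self, hk]
  obtain ⟨s₁, hs₁⟩ : ∃ s₁, (s.setVar 10 a).setVar 11 k = s₁ := ⟨_, rfl⟩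
  have ca : s₁.arr = s.arr := by rw [← hs₁]; rfl
  have c9 : s₁.var 9 = sp + 1 := by simp [← hs₁, hsp]
  have c10 : s₁.var 10 = a := by simp [← hs₁]
  have c11 : s₁.var 11 = k := by simp [← hs₁]
  have c5 : s₁.var 5 = N := by simp [← hs₁, hs.var5]
  rw [hs₁]
  by_cases hact : k < N ∧ (f k).1 = a ∧ ¬ (0 < s.arr 18 a ∧ I.menRank a (f k).2 ≠ s.arr 19 a)
  · obtain ⟨hkN, hfk, hact⟩ := hact
    have b0 := hs.arr0 k hkN
    have b2 := hs.arr2 k hkN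
    rw [hfk] at b0 b2
    rw [Prog.run_ite_true (by
      simpa [Test.Holds, Expr.eval, c10, c11, c5, ca, b0, b2, hkN] using hact)]
    simp only [Prog.run_seq, Prog.run_put, Expr.eval, c10, c11]
    have hpot := potential_update hkN hfk hk
    by_cases hF : f k ∈ F
    · rw [Prog.run_ite_true (by
        have := h6 k hkN
        simpa [Test.Holds, Expr.eval, c11, ca, Records, hF] using this)]
      have hs2 : I.HasEdges N f (s₁.setArr 16 a (k + 1)) := by
        obtain ⟨h1, h2, h3, h4, h5⟩ := hs
        refine ⟨c5, ?_, ?_, ?_, ?_⟩ <;>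
          rw [State.setArr_arr_ne _ _ _ (by decide), ca] <;> assumption
      obtain ⟨r1, r2⟩ := run_proposeProg (s := s₁.setArr 16 a (k + 1)) (T := T) (ptr := s.arr 16)
        (sp := sp) (k := k) (a := a) (b := (f k).2) hl hFE hs2
        (by simpa only [State.setArr_arr_ne, ne_eq, Nat.reduceEqDiff, not_false_eq_true, ca] using hi)
        c9 c10 c11 (by simpa [ca] using hst) hk (by rw [State.setArr_arr_self, ca]) hkN
        (Prod.ext hfk rfl) hF (by simpa [ca] using hact)
      refine ⟨⟨_, r1⟩, ?_⟩
      have r3 : (Prog.run proposeProg (s₁.setArr 16 a (k + 1))).arr 16 =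
          Function.update (s.arr 16) a (k + 1) := by
        rw [(Prog.exec_run rfl _).choose_spec.2.frame.2 16 (by decide), State.setArr_arr_self, ca]
      rw [potential, potential, r3, hsp]
      omega
    · rw [Prog.run_ite_false (by
        have := h6 k hkN
        simp only [Records, hF, false_and, not_false_eq_true, true_and, false_or] at this
        simp [Test.Holds, Expr.eval, c11, ca, this])]
      rw [Prog.run_skip]
      refine ⟨⟨T, ?_⟩, ?_⟩
      · simp only [StateInv, State.setArr_arr_self, State.setArr_arr_ne, State.setArr_var, ne_eq,
          Nat.reduceEqDiff, not_false_eq_true, ca, c9]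
        exact hi.skip hst hk hkN hfk hF
      · rw [potential, potential, State.setArr_arr_self, ca, State.setArr_var, c9, hsp]
        omega
  · rw [Prog.run_ite_false (by
      intro h
      simp only [Test.Holds, Expr.eval, c10, c11, c5, ca] at h
      obtain ⟨h1, h2, h3⟩ := h
      rw [hs.arr0 k h1] at h2
      have h2 : (f k).1 = a := Fin.ext h2
      rw [hs.arr2 k h1, h2] at h3
      exact hact ⟨h1, h2, h3⟩)]
    simp only [Prog.run_assign, Expr.eval, c9, Nat.add_sub_cancel]
    refine ⟨⟨T, ?_⟩, ?_⟩
    · simp only [StateInv, State.setVar_self, State.setVar_arr, ca]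
      refine hi.pop hst fun h1 h2 => ?_
      rw [hk] at h1 h2 ⊢
      by_contra hcon
      exact hact ⟨h1, h2, hcon⟩
    · rw [potential, potential, State.setVar_arr, State.setVar_self, ca, hsp]
      omega

end Propose

end TieInstance

namespace TieInstance

open RAM

/-- The array `A` holds at every `x` the number `val k + 1` for a position `k < i` with `P k` and
`key k = x`, or `0` if there is no such position. -/
def RecordsAt (P : ℕ → Prop) (key val : ℕ → ℕ) (i : ℕ) (A : ℕ → ℕ) : Prop :=
  ∀ x, (∃ k < i, P k ∧ key k = x ∧ A x = val k + 1) ∨ (∀ k < i, P k → key k ≠ x) ∧ A x = 0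

theorem RecordsAt.zero {P : ℕ → Prop} {key val A : ℕ → ℕ} (h : ∀ x, A x = 0) :
    RecordsAt P key val 0 A := fun x => .inr ⟨fun _ hk => absurd hk (Nat.not_lt_zero _), h x⟩

theorem RecordsAt.succ_update {P : ℕ → Prop} {key val A : ℕ → ℕ} {i : ℕ}
    (h : RecordsAt P key val i A) (hP : P i) :
    RecordsAt P key val (i + 1) (Function.update A (key i) (val i + 1)) := by
  intro x
  by_cases hx : x = key i
  · subst hx
    exact .inl ⟨i, by omega, hP, rfl, Function.update_self _ _ _⟩
  rw [Function.update_of_ne hx]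
  rcases h x with ⟨k, hk, h⟩ | ⟨h1, h2⟩
  · exact .inl ⟨k, by omega, h⟩
  · refine .inr ⟨fun k hk hPk => ?_, h2⟩
    rcases Nat.lt_succ_iff_lt_or_eq.1 hk with hk | rfl
    exacts [h1 k hk hPk, Ne.symm hx]

theorem RecordsAt.succ {P : ℕ → Prop} {key val A : ℕ → ℕ} {i : ℕ}
    (h : RecordsAt P key val i A) (hP : ¬ P i) : RecordsAt P key val (i + 1) A := by
  intro x
  rcases h x with ⟨k, hk, h⟩ | ⟨h1, h2⟩
  · exact .inl ⟨k, by omega, h⟩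
  · refine .inr ⟨fun k hk hPk => ?_, h2⟩
    rcases Nat.lt_succ_iff_lt_or_eq.1 hk with hk | rfl
    exacts [h1 k hk hPk, absurd hPk hP]

/-- The flag `v` is `1` as long as no position `k < i` satisfies `bad k`, and `0` afterwards. -/
def FlagUpTo (bad : ℕ → Prop) (i v : ℕ) : Prop :=
  v = 1 ∧ (∀ k < i, ¬ bad k) ∨ v = 0 ∧ ∃ k < i, bad k

theorem FlagUpTo.succ {bad : ℕ → Prop} {i v : ℕ} (h : FlagUpTo bad i v) (hb : ¬ bad i) :
    FlagUpTo bad (i + 1) v := by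
  rcases h with ⟨rfl, h⟩ | ⟨rfl, k, hk, h⟩
  · refine .inl ⟨rfl, fun k hk => ?_⟩
    rcases Nat.lt_succ_iff_lt_or_eq.1 hk with hk | rfl
    exacts [h k hk, hb]
  · exact .inr ⟨rfl, k, by omega, h⟩

/-! ### Reading off the live proposals and testing the candidate -/

section Answer

variable {p q N : ℕ} {I : TieInstance p q} {f g : ℕ → Fin p × Fin q}
  {F T M : Finset (Fin p × Fin q)}

/-- Writes the live proposals to array `7`; register `14` tells whether they form a super-stable
matching. -/
def collectProg : Prog :=
  .forLoop 6 5 (.seq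
    (.ite (.and (.not (.lt (.const 1) (.get 18 (.get 0 (.var 6)))))
        (.not (.and (.lt (.const 0) (.get 20 (.get 1 (.var 6))))
          (.eq (.get 21 (.get 1 (.var 6))) (.const 0))))) .skip (.assign 14 (.const 0)))
    (.ite (.eq (.get 21 (.get 1 (.var 6))) (.succ (.get 0 (.var 6))))
      (.put 7 (.get 0 (.var 6)) (.succ (.get 1 (.var 6)))) .skip))

theorem runs_collectProg {s : State} (hs : I.HasEdges N f s)
    {ptr st cur : ℕ → ℕ}
    (hi : I.ProposalInv F N f T 0 ptr st (s.arr 18) cur (s.arr 20) (s.arr 21))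
    (h14 : s.var 14 = 1) (h7 : ∀ x, s.arr 7 x = 0) {n : ℕ} (hn : N + 1 ≤ n) :
    Runs n collectProg s fun s' =>
      FlagUpTo (fun k => 1 < s.arr 18 (f k).1 ∨ 0 < s.arr 20 (f k).2 ∧ s.arr 21 (f k).2 = 0)
        N (s'.var 14) ∧
      RecordsAt (fun k => f k ∈ I.live T) (fun k => (f k).1) (fun k => (f k).2) N (s'.arr 7) := by
  refine Runs.forLoop (fun i s' =>
      FlagUpTo (fun k => 1 < s.arr 18 (f k).1 ∨ 0 < s.arr 20 (f k).2 ∧ s.arr 21 (f k).2 = 0)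
        i (s'.var 14) ∧
      RecordsAt (fun k => f k ∈ I.live T) (fun k => (f k).1) (fun k => (f k).2) i (s'.arr 7))
    hs.var5 hn ⟨.inl ⟨by simpa using h14, by simp⟩, .zero h7⟩ ?_ fun s' _ h => h
  rintro k hk s' hf hx ⟨i1, i2⟩
  have hs' := hs.of_frame hf
  have b0 := hs'.arr0 k hk
  have b1 := hs'.arr1 k hk
  have a18 := hf.2 18 (by decide)
  have a20 := hf.2 20 (by decide)
  have a21 := hf.2 21 (by decide)
  rw [Prog.run_seq]
  obtain ⟨v, hv, e⟩ : ∃ v, FlagUpTo (fun k => 1 < s.arr 18 (f k).1 ∨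
      0 < s.arr 20 (f k).2 ∧ s.arr 21 (f k).2 = 0) (k + 1) v ∧
      Prog.run (.ite (.and (.not (.lt (.const 1) (.get 18 (.get 0 (.var 6)))))
        (.not (.and (.lt (.const 0) (.get 20 (.get 1 (.var 6))))
          (.eq (.get 21 (.get 1 (.var 6))) (.const 0))))) .skip (.assign 14 (.const 0))) s' =
        s'.setVar 14 v := by
    by_cases hbad : 1 < s.arr 18 (f k).1 ∨ 0 < s.arr 20 (f k).2 ∧ s.arr 21 (f k).2 = 0
    · refine ⟨0, .inr ⟨rfl, k, by omega, hbad⟩, ?_⟩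
      rw [Prog.run_ite_false (by
        simp only [Test.Holds, Expr.eval, hx, b0, b1, a18, a20, a21]
        tauto)]
      rfl
    · refine ⟨s'.var 14, i1.succ hbad, ?_⟩
      rw [Prog.run_ite_true (by
        simp only [Test.Holds, Expr.eval, hx, b0, b1, a18, a20, a21]
        tauto)]
      simp [State.setVar]
  rw [e]
  have hlive : f k ∈ I.live T ↔ s.arr 21 (f k).2 = (f k).1 + 1 := (hi.woman (f k).2).mem_live_iff
  by_cases hL : f k ∈ I.live T
  · rw [Prog.run_ite_true (by simpa [Test.Holds, Expr.eval, hx, b0, b1, a21] using hlive.1 hL)]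
    simp only [Prog.run_put, Expr.eval, State.setVar_ne, State.setVar_arr, State.setVar_self,
      State.setArr_var, State.setArr_arr_self, ne_eq, Nat.reduceEqDiff, not_false_eq_true, hx, b0,
      b1]
    exact ⟨hv, i2.succ_update hL⟩
  · rw [Prog.run_ite_false (by
      simpa [Test.Holds, Expr.eval, hx, b0, b1, a21] using fun h => hL (hlive.2 h))]
    simp only [Prog.run_skip, State.setVar_ne, State.setVar_arr, State.setVar_self, ne_eq,
      Nat.reduceEqDiff, not_false_eq_true]
    exact ⟨hv, i2.succ hL⟩

/-- The local test made at each edge suffices, because every man or woman involved in a proposal is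
an endpoint of a listed edge. -/
theorem ProposalInv.forall_good_iff {sp : ℕ} {ptr st cnt cur best holder : ℕ → ℕ}
    (hi : I.ProposalInv F N f T sp ptr st cnt cur best holder) (hl : I.Listing N f g)
    (hFE : F ⊆ I.edges) :
    (∀ k < N, ¬ (1 < cnt (f k).1 ∨ 0 < best (f k).2 ∧ holder (f k).2 = 0)) ↔
      (∀ a b b', (a, b) ∈ I.live T → (a, b') ∈ I.live T → b = b') ∧
        ∀ a b, (a, b) ∈ T → ∃ a', (a', b) ∈ I.live T := by
  have hcnt : ∀ a : Fin p, ¬ 1 < cnt a ↔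
      ∀ b b', (a, b) ∈ I.live T → (a, b') ∈ I.live T → b = b' := by
    intro a
    rw [hi.cnt_eq, not_lt, Finset.card_le_one]
    simp only [Finset.mem_filter, Finset.mem_univ, true_and]
    constructor
    · intro h b b' hb hb'
      exact h b ((hi.woman b).mem_live_iff.1 hb) b' ((hi.woman b').mem_live_iff.1 hb')
    · intro h b hb b' hb'
      exact h b b' ((hi.woman b).mem_live_iff.2 hb) ((hi.woman b').mem_live_iff.2 hb')
  have hhol : ∀ b : Fin q, holder b ≠ 0 ↔ ∃ a', (a', b) ∈ I.live T := by
    intro b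
    have := (hi.woman b).lt
    constructor
    · intro h
      exact ⟨⟨holder b - 1, by omega⟩, (hi.woman b).mem_live_iff.2 (by simp only; omega)⟩
    · rintro ⟨a, ha⟩
      rw [(hi.woman b).mem_live_iff.1 ha]
      omega
  constructor
  · refine fun h => ⟨fun a b b' hb hb' => ?_, fun a b hab => ?_⟩
    · obtain ⟨k, hk, he⟩ := hl.exists_eq _ (hFE (hi.sound.1 (live_subset hb)))
      have := h k hk
      rw [he, not_or, hcnt] at this
      exact this.1 b b' hb hb'
    · obtain ⟨k, hk, he⟩ := hl.exists_eq _ (hFE (hi.sound.1 hab))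
      have := h k hk
      rw [he, not_or] at this
      refine (hhol b).1 fun h0 => this.2 ⟨?_, h0⟩
      refine Nat.pos_of_ne_zero fun h1 => ?_
      exact (hi.woman b).eq_zero_iff.1 h1 a hab
  · rintro ⟨h1, h2⟩ k hk (h | ⟨h, h0⟩)
    · exact (hcnt _).2 (h1 _) h
    · have : ¬ ∀ a, (a, (f k).2) ∉ T := fun h' => h.ne' ((hi.woman _).eq_zero_iff.2 h')
      push Not at this
      obtain ⟨a, ha⟩ := this
      exact (hhol _).2 (h2 a _ ha) h0

/-- The second phase. -/
def matchProg : Prog :=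
  .seq initProg (.seq (.assign 9 (.var 5)) (.seq (.while (.lt (.const 0) (.var 9)) stepProg)
    (.seq (.assign 14 (.const 1)) (.seq collectProg (.assign 0 (.var 14))))))

theorem runs_matchProg (hl : I.Listing N f g) (hFE : F ⊆ I.edges) {s : State}
    (hs : I.HasEdges N f s) (h6 : ∀ k < N, Records (f k ∈ F) 0 (s.arr 6 k))
    (hz : ∀ c, c = 7 ∨ 16 ≤ c → ∀ x, s.arr c x = 0) {n : ℕ} (hn : 3 * N + 1 ≤ n) :
    Runs n matchProg s fun s' => I.HasEdges N f s' ∧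
      ∃ M', Reports s' 7 M' ∧ I.IsManOptimalAnswer (I.superStable F) M' := by
  refine Runs.seq (runs_initProg hl hs (by omega)) fun s₁ f₁ ⟨e₁, e₁'⟩ => ?_
  have i₁ := hs.of_frame f₁
  refine Runs.seq (Mid := fun s' => s' = s₁.setVar 9 N)
    (.of_loopFree rfl (by omega) (by simp [Expr.eval, i₁.var5])) fun s₂ f₂ e₂ => ?_
  have i₂ := i₁.of_frame f₂
  have z₂ : ∀ c, 18 ≤ c → ∀ x, s₂.arr c x = 0 := by
    intro c hc x
    rw [f₂.2 c List.not_mem_nil, f₁.2 c, hz c (.inr (by omega))]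
    simp only [initProg, Prog.forLoop, Prog.arrs, List.nil_append, List.append_nil,
      List.cons_append, List.mem_cons, List.not_mem_nil, or_false]
    omega
  -- Zero cells describe the absence of proposals, and every man with an edge is on the stack, so
  -- nobody has to be at rest yet.
  have inv₂ : I.StateInv N f F ∅ s₂ := by
    subst e₂
    have hb := fun c (hc : 18 ≤ c) x => z₂ c hc x
    constructor
    · intro k hk
      have := (e₁' k hk).1
      simp only [State.setVar_arr, Finset.notMem_empty, false_iff, not_and]
      omega
    · exact ⟨Finset.empty_subset _, fun a b h => absurd h (Finset.notMem_empty _)⟩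
    · intro k hk
      obtain ⟨h1, h2⟩ := e₁' k hk
      exact ⟨_, lt_of_le_of_lt h1 hk, h2, .inl rfl⟩
    · intro b
      exact .inl ⟨hb 20 (by decide) b, hb 21 (by decide) b, by simp⟩
    · intro a
      rw [hb 18 (by decide), eq_comm, Finset.card_eq_zero]
      refine Finset.filter_eq_empty_iff.2 fun b _ => ?_
      rw [hb 21 (by decide)]
      omega
    · exact fun a b h => absurd h (Finset.notMem_empty _)
    · exact fun a b h => absurd h (Finset.notMem_empty _)
    · intro i h
      rw [State.setVar_self] at h
      exact ⟨i, h, e₁ i h⟩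
    · intro k hk
      exact .inl ⟨k, by rwa [State.setVar_self], e₁ k hk⟩
  have h6₂ : ∀ k < N, Records (f k ∈ F) 0 (s₂.arr 6 k) := by
    rw [f₂.2 6 (by decide), f₁.2 6 (by decide)]
    exact h6
  have loop : Runs n (.while (.lt (.const 0) (.var 9)) stepProg) s₂ fun s' =>
      s'.var 9 = 0 ∧ ∃ T, I.StateInv N f F T s' := by
    refine Runs.loop rfl (fun s' => ∃ T, I.StateInv N f F T s') (potential N f) ⟨∅, inv₂⟩ ?_ ?_ ?_
    · have := Finset.card_filter_le (Finset.range N) fun k => s₂.arr 16 (f k).1 ≤ k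
      rw [Finset.card_range] at this
      have h9 : s₂.var 9 = N := by rw [e₂, State.setVar_self]
      rw [potential, h9]
      omega
    · rintro s' hf hb ⟨T, hT⟩
      refine run_stepProg hl hFE (i₂.of_frame hf) ?_ hb hT
      rw [hf.2 6 (by decide)]
      exact h6₂
    · rintro s' hf hb hT
      refine ⟨?_, hT⟩
      have : ¬ 0 < s'.var 9 := hb
      omega
  refine Runs.seq loop fun s₃ f₃ ⟨v9, T, e₃⟩ => ?_
  have i₃ := i₂.of_frame f₃
  rw [StateInv, v9] at e₃
  refine Runs.seq (Mid := fun s' => s' = s₃.setVar 14 1)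
    (.of_loopFree rfl (by omega) rfl) fun s₄ f₄ e₄ => ?_
  have i₄ := i₃.of_frame f₄
  have a₄ : s₄.arr = s₃.arr := by rw [e₄]; rfl
  rw [← a₄] at e₃
  refine Runs.seq (runs_collectProg i₄ e₃ (by rw [e₄, State.setVar_self]) (fun x => ?_) (by omega))
    fun s₅ f₅ ⟨e₅, e₅'⟩ => ?_
  · rw [a₄, f₃.2 7 (by decide), f₂.2 7 (by decide), f₁.2 7 (by decide), hz 7 (.inl rfl)]
  have i₅ := i₄.of_frame f₅
  refine (Runs.of_loopFree (Post := fun s' => s' = s₅.setVar 0 (s₅.var 14)) rfl (by omega) rfl).mono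
    fun s₆ f₆ e₆ => ⟨i₅.of_frame f₆, ?_⟩
  have hC := e₃.closed hl hFE
  have hgood := e₃.forall_good_iff hl hFE
  rcases e₅ with ⟨v, hv⟩ | ⟨v, k, hk, hv⟩
  · have h12 := hgood.1 hv
    have hM := live_mem_superStable e₃.sound hC h12.1 h12.2
    refine ⟨some (I.live T), ⟨by rw [e₆, State.setVar_self, v], fun a => ?_⟩, hM,
      fun N hN => dominates_live e₃.sound hC hN⟩
    rw [e₆, State.setVar_arr]
    rcases e₅' a with ⟨k, hk, h1, h2, h3⟩ | ⟨h1, h2⟩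
    · have h2 : (f k).1 = a := Fin.ext h2
      exact .inl ⟨(f k).2, h2 ▸ h1, h3⟩
    · refine .inr ⟨fun b hb => ?_, h2⟩
      obtain ⟨k, hk, he⟩ := hl.exists_eq _ (hFE (hM.1.1 hb))
      exact h1 k hk (by simpa [he] using hb) (by simp [he])
  · refine ⟨none, by rw [Reports, e₆, State.setVar_self, v], ?_⟩
    refine Set.eq_empty_of_forall_notMem fun M hM => ?_
    exact hgood.2 (of_superStable_nonempty e₃.sound hC hM) k hk hv

/-! ## Third phase: the answer -/

/-- Copies the matching in array `7` to array `8`. -/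
def copyProg : Prog :=
  .forLoop 6 5 (.put 8 (.get 0 (.var 6)) (.get 7 (.get 0 (.var 6))))

theorem runs_copyProg {s : State} (hs : I.HasEdges N f s) (h8 : ∀ x, s.arr 8 x = 0) {n : ℕ}
    (hn : N + 1 ≤ n) : Runs n copyProg s fun s' =>
      (∀ k < N, s'.arr 8 (f k).1 = s.arr 7 (f k).1) ∧
        ∀ a : Fin p, (∀ k < N, (f k).1 ≠ a) → s'.arr 8 a = 0 := by
  refine Runs.forLoop (fun i s' => (∀ k < i, s'.arr 8 (f k).1 = s.arr 7 (f k).1) ∧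
    ∀ a : Fin p, (∀ k < i, (f k).1 ≠ a) → s'.arr 8 a = 0) hs.var5 hn (by simp [h8]) ?_
    fun s' _ h => h
  rintro k hk s' hf hx ⟨i1, i2⟩
  have hs' := hs.of_frame hf
  simp only [Prog.run_put, Expr.eval, hx, hs'.arr0 k hk, State.setVar_arr, State.setArr_self,
    Fin.val_inj, hf.2 7 (by decide)]
  refine ⟨fun l hlk => ?_, fun a ha => ?_⟩
  · split_ifs with h
    · rw [h]
    · rcases Nat.lt_succ_iff_lt_or_eq.1 hlk with h' | rfl
      exacts [i1 l h', absurd rfl h]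
  · rw [if_neg fun h => ha k (by omega) h.symm]
    exact i2 a fun l hlk => ha l (by omega)

/-- Records the ranks of the partners in arrays `22` and `23`. -/
def partnerProg : Prog :=
  .forLoop 6 5 (.ite (.eq (.get 8 (.get 0 (.var 6))) (.succ (.get 1 (.var 6))))
    (.seq (.put 22 (.get 0 (.var 6)) (.succ (.get 2 (.var 6))))
      (.put 23 (.get 1 (.var 6)) (.succ (.get 12 (.var 6))))) .skip)

theorem runs_partnerProg {s : State} (hs : I.HasEdges N f s)
    (h8 : ∀ a b, (a, b) ∈ M ↔ s.arr 8 a = b + 1) (h22 : ∀ x, s.arr 22 x = 0)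
    (h23 : ∀ x, s.arr 23 x = 0) {n : ℕ} (hn : N + 1 ≤ n) :
    Runs n partnerProg s fun s' =>
      RecordsAt (fun k => f k ∈ M) (fun k => (f k).1) (fun k => I.menRank (f k).1 (f k).2) N
        (s'.arr 22) ∧
      RecordsAt (fun k => f k ∈ M) (fun k => (f k).2) (fun k => I.womenRank (f k).2 (f k).1) N
        (s'.arr 23) := by
  refine Runs.forLoop (fun i s' =>
      RecordsAt (fun k => f k ∈ M) (fun k => (f k).1) (fun k => I.menRank (f k).1 (f k).2) i
        (s'.arr 22) ∧
      RecordsAt (fun k => f k ∈ M) (fun k => (f k).2) (fun k => I.womenRank (f k).2 (f k).1) i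
        (s'.arr 23)) hs.var5 hn ⟨.zero h22, .zero h23⟩ ?_ fun s' _ h => h
  rintro k hk s' hf hx ⟨i1, i2⟩
  have hs' := hs.of_frame hf
  have hM : f k ∈ M ↔ s.arr 8 (f k).1 = (f k).2 + 1 := h8 _ _
  have ht : Test.Holds s' (.eq (.get 8 (.get 0 (.var 6))) (.succ (.get 1 (.var 6)))) ↔ f k ∈ M := by
    rw [hM]
    simp only [Test.Holds, Expr.eval, hx, hs'.arr0 k hk, hs'.arr1 k hk, hf.2 8 (by decide)]
  by_cases hfM : f k ∈ M
  · rw [Prog.run_ite_true (ht.2 hfM)]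
    simp only [Prog.run_seq, Prog.run_put, Expr.eval, hx, hs'.arr0 k hk, hs'.arr1 k hk,
      hs'.arr2 k hk, hs'.arr12 k hk, State.setVar_arr, State.setArr_arr_self, State.setArr_arr_ne,
      State.setArr_var, ne_eq, Nat.reduceEqDiff, not_false_eq_true]
    exact ⟨i1.succ_update hfM, i2.succ_update hfM⟩
  · rw [Prog.run_ite_false (fun h => hfM (ht.1 h))]
    exact ⟨i1.succ hfM, i2.succ hfM⟩

/-- Clears register `14` if some edge blocks the matching. -/
def checkProg : Prog :=
  .forLoop 6 5 (.ite (.and (.not (.eq (.get 8 (.get 0 (.var 6))) (.succ (.get 1 (.var 6)))))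
      (.and
        (.not (.and (.lt (.const 0) (.get 22 (.get 0 (.var 6))))
          (.lt (.get 22 (.get 0 (.var 6))) (.succ (.get 2 (.var 6))))))
        (.not (.and (.lt (.const 0) (.get 23 (.get 1 (.var 6))))
          (.lt (.get 23 (.get 1 (.var 6))) (.succ (.get 12 (.var 6))))))))
    (.assign 14 (.const 0)) .skip)

/-- Since `M` is a matching, the recorded rank at a vertex is that of its only partner. A zero cell
means that the vertex is single, so its half of the blocking condition holds vacuously. -/
theorem runs_checkProg (hl : I.Listing N f g) (hMm : IsMatching I.edges M) {s : State}
    (hs : I.HasEdges N f s) (h8 : ∀ a b, (a, b) ∈ M ↔ s.arr 8 a = b + 1)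
    (h22 : RecordsAt (fun k => f k ∈ M) (fun k => (f k).1) (fun k => I.menRank (f k).1 (f k).2) N
      (s.arr 22))
    (h23 : RecordsAt (fun k => f k ∈ M) (fun k => (f k).2) (fun k => I.womenRank (f k).2 (f k).1) N
      (s.arr 23)) (h14 : s.var 14 = 1) {n : ℕ} (hn : N + 1 ≤ n) :
    Runs n checkProg s fun s' => FlagUpTo (fun k => I.Blocks I.edges M (f k)) N (s'.var 14) := by
  refine Runs.forLoop (fun i s' => FlagUpTo (fun k => I.Blocks I.edges M (f k)) i (s'.var 14))
    hs.var5 hn (.inl ⟨by simpa using h14, by simp⟩) ?_ fun s' _ h => h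
  rintro k hk s' hf hx i1
  have hs' := hs.of_frame hf
  have hM : f k ∈ M ↔ s.arr 8 (f k).1 = (f k).2 + 1 := h8 _ _
  have hman : (∀ b, ((f k).1, b) ∈ M → I.manPrefers (f k).1 (f k).2 b) ↔
      ¬ (0 < s.arr 22 (f k).1 ∧ s.arr 22 (f k).1 < I.menRank (f k).1 (f k).2 + 1) := by
    rcases h22 (f k).1 with ⟨l, hlN, h1, h2, h3⟩ | ⟨h1, h2⟩
    · have h2 : (f l).1 = (f k).1 := Fin.ext h2
      simp only [h2] at h3
      rw [h3]
      constructor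
      · intro h
        have := h (f l).2 (h2 ▸ h1)
        simp only [manPrefers] at this
        omega
      · intro h b hb
        obtain rfl : b = (f l).2 := congrArg Prod.snd (hMm.2.1 _ hb _ h1 h2.symm)
        simp only [manPrefers]
        omega
    · refine iff_of_true (fun b hb => ?_) (by omega)
      obtain ⟨l, hlN, he⟩ := hl.exists_eq _ (hMm.1 hb)
      exact absurd (by simp [he]) (h1 l hlN (by simpa [he] using hb))
  have hwoman : (∀ a, (a, (f k).2) ∈ M → I.womanPrefers (f k).2 (f k).1 a) ↔
      ¬ (0 < s.arr 23 (f k).2 ∧ s.arr 23 (f k).2 < I.womenRank (f k).2 (f k).1 + 1) := by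
    rcases h23 (f k).2 with ⟨l, hlN, h1, h2, h3⟩ | ⟨h1, h2⟩
    · have h2 : (f l).2 = (f k).2 := Fin.ext h2
      simp only [h2] at h3
      rw [h3]
      constructor
      · intro h
        have := h (f l).1 (h2 ▸ h1)
        simp only [womanPrefers] at this
        omega
      · intro h a ha
        obtain rfl : a = (f l).1 := congrArg Prod.fst (hMm.2.2 _ ha _ h1 h2.symm)
        simp only [womanPrefers]
        omega
    · refine iff_of_true (fun a ha => ?_) (by omega)
      obtain ⟨l, hlN, he⟩ := hl.exists_eq _ (hMm.1 ha)
      exact absurd (by simp [he]) (h1 l hlN (by simpa [he] using ha))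
  by_cases hb : I.Blocks I.edges M (f k)
  · rw [Prog.run_ite_true]
    · exact .inr ⟨by simp [Expr.eval], k, by omega, hb⟩
    · simp only [Test.Holds, Expr.eval, hx, hs'.arr0 k hk, hs'.arr1 k hk, hs'.arr2 k hk,
        hs'.arr12 k hk, hf.2 8 (by decide), hf.2 22 (by decide), hf.2 23 (by decide)]
      rw [← hman, ← hwoman, ← hM]
      exact hb.2
  · rw [Prog.run_ite_false]
    · rw [Prog.run_skip, State.setVar_ne _ _ (by decide)]
      exact i1.succ hb
    · simp only [Test.Holds, Expr.eval, hx, hs'.arr0 k hk, hs'.arr1 k hk, hs'.arr2 k hk,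
        hs'.arr12 k hk, hf.2 8 (by decide), hf.2 22 (by decide), hf.2 23 (by decide)]
      rw [← hman, ← hwoman, ← hM]
      exact fun h => hb ⟨hl.mem k hk, h⟩

/-- The third phase. -/
def answerProg : Prog :=
  .ite (.eq (.var 0) (.const 0)) .skip
    (.seq copyProg (.seq (.put 8 (.var 1) (.succ (.var 2))) (.seq partnerProg
      (.seq (.assign 14 (.const 1)) (.seq checkProg (.assign 0 (.var 14)))))))

theorem runs_answerProg (hl : I.Listing N f g) {m : Fin p} {w : Fin q} (hmw : (m, w) ∈ I.edges)
    {M' : Option (Finset (Fin p × Fin q))}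
    (hM' : I.IsManOptimalAnswer (I.superStable (I.reducedEdges m w)) M') {s : State}
    (hs : I.HasEdges N f s) (h1 : s.var 1 = m) (h2 : s.var 2 = w) (h7 : Reports s 7 M')
    (hz : ∀ c, c = 8 ∨ 22 ≤ c → ∀ x, s.arr c x = 0) {n : ℕ} (hn : N + 1 ≤ n) :
    Runs n answerProg s fun s' => Reports s' 8 (I.algResult m w M') := by
  cases M' with
  | none =>
    have h0 : s.var 0 = 0 := h7
    exact Runs.ite_true h0 (by omega) (.of_loopFree rfl (by omega) h0)
  | some M' =>
    obtain ⟨h0, h7⟩ := h7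
    have hMm := insert_isMatching hmw hM'.1.1
    obtain ⟨M, hM⟩ : ∃ M, insert (m, w) M' = M := ⟨_, rfl⟩
    rw [hM] at hMm
    refine Runs.ite_false (by simp [Test.Holds, Expr.eval, h0]) (by omega) ?_
    refine Runs.seq (runs_copyProg hs (hz 8 (.inl rfl)) hn) fun s₁ f₁ ⟨e₁, e₁'⟩ => ?_
    have i₁ := hs.of_frame f₁
    have v1₁ : s₁.var 1 = m := by rw [f₁.1 1 (by decide), h1]
    have v2₁ : s₁.var 2 = w := by rw [f₁.1 2 (by decide), h2]
    refine Runs.seq (Mid := fun s' => s' = s₁.setArr 8 m (w + 1))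
      (.of_loopFree rfl (by omega) (by simp [Expr.eval, v1₁, v2₁])) fun s₂ f₂ e₂ => ?_
    have i₂ := i₁.of_frame f₂
    have r₂ : ∀ a : Fin p, (∃ b : Fin q, (a, b) ∈ M ∧ s₂.arr 8 a = b + 1) ∨
        ((∀ b : Fin q, (a, b) ∉ M) ∧ s₂.arr 8 a = 0) := by
      intro a
      rw [e₂, State.setArr_self]
      by_cases ham : a = m
      · subst ham
        exact .inl ⟨w, hM ▸ Finset.mem_insert_self _ _, if_pos rfl⟩
      · rw [if_neg fun h => ham (Fin.ext h), ← hM]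
        have hins : ∀ b, (a, b) ∈ insert (m, w) M' ↔ (a, b) ∈ M' := by simp [ham]
        simp only [hins]
        -- The copying loop visits only men with an edge. Any other man is single in `M'`, and his
        -- cell still holds its initial `0`.
        by_cases hk : ∃ k < N, (f k).1 = a
        · obtain ⟨k, hk, rfl⟩ := hk
          rw [e₁ k hk]
          exact h7 _
        · push Not at hk
          refine .inr ⟨fun b hb => ?_, e₁' a hk⟩
          obtain ⟨k, hkN, he⟩ := hl.exists_eq _ (reducedEdges_subset (hM'.1.1.1 hb))
          exact hk k hkN (by rw [he])
    have h8₂ : ∀ a b, (a, b) ∈ M ↔ s₂.arr 8 a = b + 1 := by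
      intro a b
      rcases r₂ a with ⟨b', hb', he⟩ | ⟨hb', he⟩
      · constructor
        · intro hb
          obtain rfl : b = b' := congrArg Prod.snd (hMm.2.1 _ hb _ hb' rfl)
          exact he
        · intro h
          obtain rfl : b = b' := Fin.ext (by omega)
          exact hb'
      · exact iff_of_false (hb' b) (by omega)
    refine Runs.seq (runs_partnerProg i₂ h8₂ (fun x => ?_) (fun x => ?_) hn)
      fun s₃ f₃ ⟨e₃, e₃'⟩ => ?_
    · rw [f₂.2 22 (by decide), f₁.2 22 (by decide), hz 22 (.inr le_rfl)]
    · rw [f₂.2 23 (by decide), f₁.2 23 (by decide), hz 23 (.inr (by decide))]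
    have i₃ := i₂.of_frame f₃
    refine Runs.seq (Mid := fun s' => s' = s₃.setVar 14 1)
      (.of_loopFree rfl (by omega) rfl) fun s₄ f₄ e₄ => ?_
    have i₄ := i₃.of_frame f₄
    have a₄ : s₄.arr = s₃.arr := by rw [e₄]; rfl
    rw [← f₃.2 8 (by decide), ← a₄] at h8₂ r₂
    rw [← a₄] at e₃ e₃'
    refine Runs.seq (runs_checkProg hl hMm i₄ h8₂ e₃ e₃' (by rw [e₄, State.setVar_self]) hn)
      fun s₅ f₅ e₅ => ?_
    refine Runs.of_loopFree rfl (by omega) ?_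
    rw [Prog.run_assign]
    rw [← f₅.2 8 (by decide)] at r₂
    have hss : M ∈ I.superStable I.edges ↔ ∀ k < N, ¬ I.Blocks I.edges M (f k) := by
      refine ⟨fun h k _ => h.2 _, fun h => ⟨hMm, fun e he => ?_⟩⟩
      obtain ⟨k, hk, rfl⟩ := hl.exists_eq _ he.1
      exact h k hk he
    subst hM
    simp only [algResult]
    rcases e₅ with ⟨v, hv⟩ | ⟨v, k, hk, hv⟩
    · rw [if_pos (hss.2 hv)]
      exact ⟨by simpa [Expr.eval] using v, r₂⟩
    · rw [if_neg fun h => hss.1 h k hk hv]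
      simpa [Reports, Expr.eval] using v

end Answer

end TieInstance

/-! ### Assembly of the three phases -/

theorem mainTheorem8 :
    ∃ (P₁ P₂ P₃ : RAM.Prog) (C : ℕ),
      ∀ (p q : ℕ) (I : TieInstance p q) (m : Fin p) (w : Fin q), (m, w) ∈ I.edges →
        (∀ M' : Option (Finset (Fin p × Fin q)),
          I.IsManOptimalAnswer (I.superStable (I.reducedEdges m w)) M' →
            I.IsManOptimalAnswer (I.superStableWith m w) (I.algResult m w M')) ∧
        ∃ (M' : Option (Finset (Fin p × Fin q))) (t₁ t₂ t₃ : ℕ) (s₁ s₂ s₃ : RAM.State),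
          -- deletion of the edges
          RAM.Exec P₁ (I.inputState m w) t₁ s₁ ∧ I.HoldsEdgeSet s₁ 6 (I.reducedEdges m w) ∧
          -- man-optimal super-stable matching of the reduced graph
          RAM.Exec P₂ s₁ t₂ s₂ ∧ TieInstance.Reports s₂ 7 M' ∧
          I.IsManOptimalAnswer (I.superStable (I.reducedEdges m w)) M' ∧
          -- the answer
          RAM.Exec P₃ s₂ t₃ s₃ ∧ TieInstance.Reports s₃ 8 (I.algResult m w M') ∧
          I.IsManOptimalAnswer (I.superStableWith m w) (I.algResult m w M') ∧
          t₁ + t₂ + t₃ ≤ C * I.edges.card := by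
  -- The phases need factors `2 * |E| + 1`, `3 * |E| + 1` and `|E| + 1`. The edge `(m, w)` makes
  -- `|E|` positive, so `4 * |E|` is enough for all of them.
  refine ⟨TieInstance.reduceProg, TieInstance.matchProg, TieInstance.answerProg,
    (TieInstance.reduceProg.bound + TieInstance.matchProg.bound + TieInstance.answerProg.bound) * 4,
    fun p q I m w hmw => ⟨TieInstance.algResult_isManOptimalAnswer hmw, ?_⟩⟩
  have hpos : 0 < I.edges.card := Finset.card_pos.2 ⟨_, hmw⟩
  have hl := I.listing (m := m) (w := w)
  have hz : ∀ c, 6 ≤ c → ∀ x, (I.inputState m w).arr c x = 0 := by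
    intro c hc x
    obtain ⟨d, rfl⟩ : ∃ d, c = d + 6 := ⟨c - 6, by omega⟩
    rfl
  obtain ⟨t₁, s₁, x₁, b₁, e₁, r₁⟩ := TieInstance.runs_reduceProg (n := 4 * I.edges.card) hl hmw
    TieInstance.hasInput rfl rfl rfl hz (by omega)
  have ne₁ : ∀ c, c = 7 ∨ c = 8 ∨ 16 ≤ c → ∀ x, s₁.arr c x = 0 := by
    intro c hc x
    rw [x₁.frame.2 c, hz c (by omega)]
    have : ∀ d ∈ TieInstance.reduceProg.arrs, d ≠ 7 ∧ d ≠ 8 ∧ d < 16 := by decide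
    intro h
    have := this c h
    omega
  obtain ⟨t₂, s₂, x₂, b₂, e₂, M', r₂, o₂⟩ := TieInstance.runs_matchProg (n := 4 * I.edges.card) hl
    TieInstance.reducedEdges_subset e₁ r₁ (fun c hc => ne₁ c (by omega)) (by omega)
  have ne₂ : ∀ c, c = 8 ∨ 22 ≤ c → ∀ x, s₂.arr c x = 0 := by
    intro c hc x
    rw [x₂.frame.2 c, ne₁ c (by omega)]
    have : ∀ d ∈ TieInstance.matchProg.arrs, d ≠ 8 ∧ d < 22 := by decide
    intro h
    have := this c h
    omega
  obtain ⟨t₃, s₃, x₃, b₃, r₃⟩ := TieInstance.runs_answerProg (n := 4 * I.edges.card) hl hmw o₂ e₂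
    ((x₂.frame.1 1 (by decide)).trans (x₁.frame.1 1 (by decide)))
    ((x₂.frame.1 2 (by decide)).trans (x₁.frame.1 2 (by decide))) r₂ ne₂ (by omega)
  refine ⟨M', t₁, t₂, t₃, s₁, s₂, s₃, x₁, fun k hk => ?_, x₂, r₂, o₂, x₃, r₃,
    TieInstance.algResult_isManOptimalAnswer hmw M' o₂, ?_⟩
  · rw [← TieInstance.menEnum_eq (m := m) (w := w) hk]
    rcases r₁ k (TieInstance.length_menEntries ▸ hk) with ⟨h, h'⟩ | ⟨h, h'⟩
    · rw [if_pos h, h']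
    · rw [if_neg h, h']
  · rw [Nat.mul_assoc, Nat.add_mul, Nat.add_mul]
    omega
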